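/- Let $0<k<k'<n$ and let $\varkappa$ be an integer with $k\le\varkappa<n-k'$. For $1\le m<n$ let $G_{n,m}$ be the Grassmannian of $m$-dimensional linear subspaces of $\mathbb R^n$ with its $O(n)$-invariant probability measure, and let $G(n,m)$ be the affine Grassmannian of $m$-dimensional affine planes $\tau=\xi+u\equiv(\xi,u)$, $\xi\in G_{n,m}$, $u\in\xi^\perp$, with the measure $d\tau=d\xi\,du$ ($du$ the Euclidean volume on $\xi^\perp$) and $|\tau|=|u|$. For a linear subspace $h$ let $G_m(h)$ be the Grassmannian of $m$-dimensional subspaces of $h$ and $d_h$ its orthogonally invariant probability measure. For $f:G(n,k)\to\mathbb C$ and $m\in\{k',\,k'+\varkappa\}$ put $$(Rf)(\eta,v)=\int_{G_k(\eta)}d_\eta\xi\int_{\xi^\perp\cap\eta}f(\xi,v+x)\,dx,\qquad \eta\in G_{n,m},\ v\in\eta^\perp ;$$ this is denoted $Rf$ for $m=k'$ and $\tilde Rf$ for $m=k'+\varkappa$. For $h\in G_{n,k'+\varkappa}$, $\alpha\in h^\perp$ and $\xi\in G_k(h)$ put $$g_{h,\alpha}(\xi)=\int_{\xi^\perp\cap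 h}f(\xi,y+\alpha)\,dy .$$ (i) Let $f\in L^p(G(n,k))$, $1\le p<\frac{n-k}{k'-k+\varkappa}$. Then for almost every $\tilde\zeta=(h,\alpha)\in G(n,k'+\varkappa)$: $(\tilde R|f|)(\tilde\zeta)<\infty$; the integral $g_{h,\alpha}(\xi)$ converges absolutely for almost every $\xi\in G_k(h)$ and $g_{h,\alpha}\in L^1(G_k(h))$; and for almost every $\eta\in G_{k'}(h)$, $$\int_{G_k(\eta)}g_{h,\alpha}(\xi)\,d_\eta\xi=\int_\pi (Rf)(\eta,v)\,d_\pi v,\qquad \pi=(\eta^\perp\cap h)+\alpha,\tag{$*$}$$ where $d_\pi v$ is the Euclidean volume on the $\varkappa$-dimensional plane $\pi\subset\eta^\perp$ and all integrals exist in the Lebesgue sense. If $f$ is moreover Borel measurable, the last two assertions hold for every $\tilde\zeta=(h,\alpha)$ with $(\tilde R|f|)(\tilde\zeta)<\infty$. (ii) Let $f$ be continuous on $G(n,k)$ with $f(\tau)=O(|\tau|^{-\mu})$ as $|\tau|\to\infty$, where $\mu>k'-k+\varkappa$. Then for every $\tilde\zeta=(h,\alpha)\in G(n,k'+\varkappa)$: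 $(\tilde R|f|)(\tilde\zeta)<\infty$; $g_{h,\alpha}(\xi)$ converges absolutely for every $\xi\in G_k(h)$, and $g_{h,\alpha}$ is continuous (hence integrable) on $G_k(h)$; and $(*)$ holds, with all integrals existing in the Lebesgue sense, for every $\eta\in G_{k'}(h)$. -/

import Mathlib

open MeasureTheory Filter Topology
open scoped ENNReal

noncomputable section

namespace RadonGrassmann

variable {V : Type} [NormedAddCommGroup V] [InnerProductSpace ℝ V] [FiniteDimensional ℝ V]

/-! ### Lebesgue measure on a linear subspace -/

/-- The Euclidean volume of a linear subspace `W`, i.e. Lebesgue measure in any orthonormal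
coordinates of `W`. (The instance is given explicitly because `volume` on a subtype could also be
read as the restriction of the volume of the ambient space.) -/
def eucl [MeasurableSpace V] [BorelSpace V] (W : Submodule ℝ V) : Measure W :=
  (measureSpaceOfInnerProductSpace : MeasureSpace W).volume

/-! ### The compact Grassmannian -/

/-- The Grassmannian of `k`-dimensional linear subspaces of `V`.  For a subspace `h`, the
Grassmannian of `k`-dimensional subspaces of `h` is `Gr k h`. -/
@[ext]
structure Gr (k : ℕ) (V : Type) [NormedAddCommGroup V] [InnerProductSpace ℝ V] : Type where
  sub : Submodule ℝ V
  finrank_eq : Module.finrank ℝ sub = k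

/-- The usual topology of the Grassmannian: subspaces are identified with their orthogonal
projections. -/
instance (k : ℕ) : TopologicalSpace (Gr k V) :=
  TopologicalSpace.induced (fun W => W.sub.starProjection) inferInstance

instance (k : ℕ) : MeasurableSpace (Gr k V) := borel _

instance (k : ℕ) : BorelSpace (Gr k V) := ⟨rfl⟩

/-- A subspace of `h`, viewed as a subspace of the ambient space. -/
def Gr.incl {k : ℕ} {h : Submodule ℝ V} (ξ : Gr k h) : Gr k V :=
  ⟨ξ.sub.map h.subtype, by
    rw [(Submodule.equivMapOfInjective h.subtype h.injective_subtype ξ.sub).symm.finrank_eq]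
    exact ξ.finrank_eq⟩

/-- The orthogonal group of `V`. -/
abbrev Orth (V : Type) [NormedAddCommGroup V] [InnerProductSpace ℝ V] [CompleteSpace V] :=
  unitary (V →L[ℝ] V)

instance [CompleteSpace V] : CompactSpace (Orth V) := by
  have : ProperSpace (V →L[ℝ] V) := FiniteDimensional.proper ℝ _
  refine isCompact_iff_compactSpace.mp (Metric.isCompact_of_isClosed_isBounded ?_ ?_)
  · have h1 : Continuous fun T : V →L[ℝ] V => star T * T := by fun_prop
    have h2 : Continuous fun T : V →L[ℝ] V => T * star T := by fun_prop
    exact (isClosed_singleton.preimage h1).inter (isClosed_singleton.preimage h2)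
  · refine (Metric.isBounded_closedBall (x := (0 : V →L[ℝ] V)) (r := 1)).subset fun T hT => ?_
    rw [mem_closedBall_zero_iff]
    refine T.opNorm_le_bound zero_le_one fun x => ?_
    rw [one_mul, ContinuousLinearMap.norm_map_of_mem_unitary hT]

/-- The image `U W` of a subspace `W` under an orthogonal transformation `U`. -/
def Gr.rotate [CompleteSpace V] {k : ℕ} (U : Orth V) (W : Gr k V) : Gr k V :=
  ⟨W.sub.map (U.1 : V →ₗ[ℝ] V), by
    have hU : Function.Injective (U.1 : V →ₗ[ℝ] V) := fun x y hxy => by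
      have h := ContinuousLinearMap.norm_map_of_mem_unitary U.2 (x - y)
      rw [map_sub, sub_eq_zero.mpr (show U.1 x = U.1 y from hxy), norm_zero] at h
      exact sub_eq_zero.mp (norm_eq_zero.mp h.symm)
    rw [(Submodule.equivMapOfInjective _ hU W.sub).symm.finrank_eq]
    exact W.finrank_eq⟩

open Classical in
/-- The orthogonally invariant probability measure on the Grassmannian: the image of the normalized
Haar measure of the orthogonal group under `U ↦ U W₀`, for some (equivalently any) base point
`W₀`. -/
def Gr.measure (k : ℕ) (V : Type) [NormedAddCommGroup V] [InnerProductSpace ℝ V]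
    [FiniteDimensional ℝ V] [CompleteSpace V] : Measure (Gr k V) :=
  if hne : Nonempty (Gr k V) then
    (Measure.haarMeasure (⊤ : TopologicalSpace.PositiveCompacts (Orth V))).map
      (fun U => Gr.rotate U hne.some)
  else 0

/-- The Funk–Radon transform on the Grassmannians of `V`:
`g ↦ ∫_{ξ ⊂ η} g(ξ) d_η ξ`, `η` of dimension `k'`. -/
def funk {k k' : ℕ} (g : Gr k V → ℂ) (η : Gr k' V) : ℂ :=
  ∫ ξ : Gr k η.sub, g ξ.incl ∂(Gr.measure k η.sub)

/-! ### The affine Grassmannian -/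

/-- The affine Grassmannian of `k`-dimensional affine planes in `V`. -/
@[ext]
structure AffGr (k : ℕ) (V : Type) [NormedAddCommGroup V] [InnerProductSpace ℝ V] : Type where
  aff : AffineSubspace ℝ V
  nonempty : (aff : Set V).Nonempty
  finrank_eq : Module.finrank ℝ aff.direction = k

/-- The plane `ξ + u`. -/
def AffGr.of {k : ℕ} (ξ : Gr k V) (u : V) : AffGr k V :=
  ⟨AffineSubspace.mk' u ξ.sub, ⟨u, AffineSubspace.self_mem_mk' u ξ.sub⟩, by
    rw [AffineSubspace.direction_mk']; exact ξ.finrank_eq⟩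

/-- The linear subspace `ξ` parallel to `τ = ξ + u`. -/
def AffGr.dir {k : ℕ} (τ : AffGr k V) : Gr k V := ⟨τ.aff.direction, τ.finrank_eq⟩

/-- The unique point `u` of `τ` that is orthogonal to the direction of `τ`: the orthogonal
projection of the origin to `τ`. -/
def AffGr.foot {k : ℕ} (τ : AffGr k V) : V :=
  haveI : Nonempty τ.aff := τ.nonempty.to_subtype
  EuclideanGeometry.orthogonalProjection τ.aff 0

/-- The topology of the affine Grassmannian, from the parametrization of `τ` by its direction
`ξ` and the point `u ∈ ξᗮ` with `τ = ξ + u`. -/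
instance (k : ℕ) : TopologicalSpace (AffGr k V) :=
  TopologicalSpace.induced (fun τ => (τ.dir, τ.foot)) inferInstance

instance (k : ℕ) : MeasurableSpace (AffGr k V) := borel _

instance (k : ℕ) : BorelSpace (AffGr k V) := ⟨rfl⟩

/-- The distance of a plane to the origin. -/
def AffGr.dist0 {k : ℕ} (τ : AffGr k V) : ℝ := Metric.infDist 0 (τ.aff : Set V)

/-- The Euclidean volume `du` of `ξᗮ`, carried over to the planes `ξ + u`, `u ∈ ξᗮ`. -/
def AffGr.fibre {k : ℕ} [MeasurableSpace V] [BorelSpace V] (ξ : Gr k V) : Measure (AffGr k V) :=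
  (eucl ξ.subᗮ).map fun u : ↥ξ.subᗮ => AffGr.of ξ (u : V)

/-- The measure `dτ = dξ du` on the affine Grassmannian, where `τ = ξ + u`, `dξ` is the invariant
probability measure on the Grassmannian and `du` is the Euclidean volume of `ξᗮ`. -/
def AffGr.measure (k : ℕ) (V : Type) [NormedAddCommGroup V] [InnerProductSpace ℝ V]
    [FiniteDimensional ℝ V] [CompleteSpace V] [MeasurableSpace V] [BorelSpace V] :
    Measure (AffGr k V) :=
  (Gr.measure k V).bind AffGr.fibre

/-! ### The measures are what they should be

`Gr.measure` is an orthogonally invariant probability measure; `τ ↦ (dir τ, foot τ)` parametrizes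
the affine Grassmannian, `|τ|` is the norm of the foot point, and `ξ ↦ AffGr.fibre ξ` is measurable,
so that `AffGr.measure` is the iterated integral `dξ du`. -/

theorem Gr.starProjection_rotate [CompleteSpace V] {k : ℕ} (U : Orth V) (W : Gr k V) :
    (Gr.rotate U W).sub.starProjection = U.1 * W.sub.starProjection * star U.1 := by
  ext x
  exact Submodule.starProjection_map_apply (Unitary.linearIsometryEquiv U) W.sub x

theorem Gr.continuous_rotate [CompleteSpace V] {k : ℕ} (W : Gr k V) :
    Continuous fun U : Orth V => Gr.rotate U W := by
  refine continuous_induced_rng.mpr ?_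
  have : (fun W : Gr k V => W.sub.starProjection) ∘ (fun U : Orth V => Gr.rotate U W)
      = fun U : Orth V => U.1 * W.sub.starProjection * star U.1 := by
    funext U; exact Gr.starProjection_rotate U W
  rw [this]
  fun_prop

theorem Gr.isProbabilityMeasure [CompleteSpace V] {k : ℕ} (h : k ≤ Module.finrank ℝ V) :
    IsProbabilityMeasure (Gr.measure k V) := by
  have hne : Nonempty (Gr k V) := by
    obtain ⟨f, hf⟩ := exists_linearIndependent_of_le_finrank (R := ℝ) (M := V) h
    exact ⟨⟨Submodule.span ℝ (Set.range f), by simpa using finrank_span_eq_card hf⟩⟩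
  rw [Gr.measure, dif_pos hne]
  have : IsProbabilityMeasure
      (Measure.haarMeasure (⊤ : TopologicalSpace.PositiveCompacts (Orth V))) :=
    ⟨Measure.haarMeasure_self⟩
  exact Measure.isProbabilityMeasure_map (Gr.continuous_rotate _).measurable.aemeasurable

theorem Gr.rotate_mul [CompleteSpace V] {k : ℕ} (U U' : Orth V) (W : Gr k V) :
    Gr.rotate (U * U') W = Gr.rotate U (Gr.rotate U' W) := by
  apply Gr.ext
  exact (Submodule.map_comp _ _ _)

theorem Gr.continuous_rotate' [CompleteSpace V] {k : ℕ} (U : Orth V) :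
    Continuous fun W : Gr k V => Gr.rotate U W := by
  refine continuous_induced_rng.mpr ?_
  have : (fun W : Gr k V => W.sub.starProjection) ∘ (fun W => Gr.rotate U W)
      = fun W : Gr k V => U.1 * W.sub.starProjection * star U.1 := by
    funext W; exact Gr.starProjection_rotate U W
  rw [this]
  have : Continuous fun W : Gr k V => W.sub.starProjection := continuous_induced_dom
  fun_prop

theorem Gr.map_rotate_measure [CompleteSpace V] {k : ℕ} (U : Orth V) :
    (Gr.measure k V).map (Gr.rotate U) = Gr.measure k V := by
  rw [Gr.measure]
  split_ifs with hne
  · rw [Measure.map_map (Gr.continuous_rotate' U).measurable (Gr.continuous_rotate _).measurable]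
    conv_rhs => rw [← MeasureTheory.map_mul_left_eq_self
      (Measure.haarMeasure (⊤ : TopologicalSpace.PositiveCompacts (Orth V))) U]
    rw [Measure.map_map (Gr.continuous_rotate _).measurable (measurable_const_mul U)]
    congr 1
    funext U'
    exact (Gr.rotate_mul _ _ _).symm
  · simp

theorem Gr.exists_rotate [CompleteSpace V] {k : ℕ} (W W' : Gr k V) :
    ∃ U : Orth V, Gr.rotate U W = W' := by
  let e : W.sub ≃ₗᵢ[ℝ] W'.sub := (stdOrthonormalBasis ℝ W.sub).repr.trans
    (((stdOrthonormalBasis ℝ W'.sub).reindex (finCongr (W'.finrank_eq.trans W.finrank_eq.symm))).repr.symm)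
  let L : V →ₗᵢ[ℝ] V := (W'.sub.subtypeₗᵢ.comp e.toLinearIsometry).extend
  let E : V ≃ₗᵢ[ℝ] V := L.toLinearIsometryEquiv rfl
  refine ⟨Unitary.linearIsometryEquiv.symm E, Gr.ext ?_⟩
  ext x
  constructor
  · rintro ⟨y, hy, rfl⟩
    have : L y = (e ⟨y, hy⟩ : V) :=
      (W'.sub.subtypeₗᵢ.comp e.toLinearIsometry).extend_apply ⟨y, hy⟩
    exact (show L y ∈ W'.sub from this ▸ (e ⟨y, hy⟩).2)
  · intro hx
    refine ⟨e.symm ⟨x, hx⟩, (e.symm ⟨x, hx⟩).2, ?_⟩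
    have : L (e.symm ⟨x, hx⟩ : V) = (e (e.symm ⟨x, hx⟩) : V) :=
      (W'.sub.subtypeₗᵢ.comp e.toLinearIsometry).extend_apply (e.symm ⟨x, hx⟩)
    rw [e.apply_symm_apply] at this
    exact this

theorem AffGr.foot_of {k : ℕ} (ξ : Gr k V) (u : V) (hu : u ∈ ξ.subᗮ) :
    (AffGr.of ξ u).foot = u := by
  have : Nonempty (AffGr.of ξ u).aff := (AffGr.of ξ u).nonempty.to_subtype
  refine EuclideanGeometry.coe_orthogonalProjection_eq_iff_mem.mpr
    ⟨AffineSubspace.self_mem_mk' _ _, ?_⟩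
  simp only [AffGr.of, AffineSubspace.direction_mk']
  simpa using hu

theorem AffGr.dir_of {k : ℕ} (ξ : Gr k V) (u : V) : (AffGr.of ξ u).dir = ξ :=
  Gr.ext (AffineSubspace.direction_mk' _ _)

theorem AffGr.of_dir_foot {k : ℕ} (τ : AffGr k V) : AffGr.of τ.dir τ.foot = τ := by
  have : Nonempty τ.aff := τ.nonempty.to_subtype
  exact AffGr.ext (AffineSubspace.mk'_eq (EuclideanGeometry.orthogonalProjection_mem _))

theorem AffGr.dist0_eq {k : ℕ} (τ : AffGr k V) : τ.dist0 = ‖τ.foot‖ := by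
  have : Nonempty τ.aff := τ.nonempty.to_subtype
  have := EuclideanGeometry.dist_orthogonalProjection_eq_infDist τ.aff (0 : V)
  rw [dist_zero_left] at this
  exact this.symm

instance {k : ℕ} : T0Space (Gr k V) :=
  (Topology.IsEmbedding.mk ⟨rfl⟩ (fun W W' h => Gr.ext
    (by simpa using congrArg (fun T : V →L[ℝ] V => T.range) h)) :
      Topology.IsEmbedding fun W : Gr k V => W.sub.starProjection).t0Space

instance {k : ℕ} : SecondCountableTopology (Gr k V) :=
  (Topology.IsInducing.mk rfl :
      Topology.IsInducing fun W : Gr k V => W.sub.starProjection).secondCountableTopology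

theorem AffGr.continuous_of {k : ℕ} {X : Type*} [TopologicalSpace X] {a : X → Gr k V} {b : X → V}
    (ha : Continuous a) (hb : Continuous b) (hab : ∀ x, b x ∈ (a x).1ᗮ) :
    Continuous fun x => AffGr.of (a x) (b x) := by
  refine continuous_induced_rng.mpr ?_
  refine (ha.prodMk hb).congr fun x => ?_
  simp [AffGr.dir_of, AffGr.foot_of _ _ (hab x)]

theorem Gr.orthogonal_rotate [CompleteSpace V] {k : ℕ} (U : Orth V) (W : Gr k V) :
    (Gr.rotate U W).subᗮ = W.subᗮ.map ((Unitary.linearIsometryEquiv U).toLinearEquiv : V →ₗ[ℝ] V) := by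
  exact (Submodule.map_orthogonal_equiv W.sub (Unitary.linearIsometryEquiv U)).symm

theorem AffGr.fibre_rotate [CompleteSpace V] [MeasurableSpace V] [BorelSpace V] {k : ℕ} (U : Orth V)
    (W : Gr k V) : AffGr.fibre (Gr.rotate U W) =
      (eucl W.subᗮ).map fun u : ↥W.subᗮ => AffGr.of (Gr.rotate U W) (U.1 u) := by
  let f := (Unitary.linearIsometryEquiv U)
  have hp := Gr.orthogonal_rotate U W
  let e : ↥W.subᗮ ≃ₗᵢ[ℝ] ↥(Gr.rotate U W).subᗮ :=
    (f.submoduleMap W.subᗮ).trans (LinearIsometryEquiv.ofEq _ _ hp.symm)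
  have he : (eucl W.subᗮ).map e = eucl (Gr.rotate U W).subᗮ :=
    e.measurePreserving.map_eq
  rw [AffGr.fibre, ← he, Measure.map_map]
  · rfl
  · exact (AffGr.continuous_of continuous_const continuous_subtype_val fun x => x.2).measurable
  · exact e.continuous.measurable

theorem AffGr.measurable_fibre [CompleteSpace V] [MeasurableSpace V] [BorelSpace V] {k : ℕ} :
    Measurable (AffGr.fibre (k := k) (V := V)) := by
  rcases isEmpty_or_nonempty (Gr k V) with h | ⟨⟨W⟩⟩
  · exact measurable_of_empty _
  have hc : IsClosed (unitary (V →L[ℝ] V) : Set (V →L[ℝ] V)) :=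
    (isCompact_iff_compactSpace.mpr (inferInstance : CompactSpace (Orth V))).isClosed
  have : PolishSpace (Orth V) := hc.polishSpace
  have hs : Function.Surjective fun U : Orth V => Gr.rotate U W := fun W' => Gr.exists_rotate W W'
  rw [← (Gr.continuous_rotate W).measurable.measurable_comp_iff_of_surjective hs]
  have hF : Measurable fun p : Orth V × ↥W.subᗮ => AffGr.of (Gr.rotate p.1 W) (p.1.1 p.2) := by
    refine (AffGr.continuous_of ((Gr.continuous_rotate W).comp continuous_fst) ?_ ?_).measurable
    · have h1 : Continuous fun p : Orth V × ↥W.subᗮ => p.1.1 := by fun_prop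
      have h2 : Continuous fun p : Orth V × ↥W.subᗮ => (p.2 : V) := by fun_prop
      exact h1.clm_apply h2
    · intro p
      change _ ∈ (Gr.rotate p.1 W).subᗮ
      rw [Gr.orthogonal_rotate]
      exact ⟨p.2, p.2.2, rfl⟩
  refine Measure.measurable_of_measurable_coe _ fun s hs => ?_
  have : SFinite (eucl W.subᗮ) := by unfold eucl; infer_instance
  convert (measurable_measure_prodMk_left (ν := eucl W.subᗮ) (hF hs)) using 1
  funext U
  simp only [Function.comp, AffGr.fibre_rotate]
  exact Measure.map_apply (hF.comp measurable_prodMk_left) hs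

/-- The space `C_μ`: continuous functions with `f(τ) = O(|τ|^{-μ})` as `|τ| → ∞`. -/
def MemC {k : ℕ} (μ : ℝ) (f : AffGr k V → ℂ) : Prop :=
  Continuous f ∧ f =O[comap AffGr.dist0 atTop] fun τ => τ.dist0 ^ (-μ)

/-! ### Radon transforms -/

variable [MeasurableSpace V] [BorelSpace V]

/-- `(R f)(ζ) = ∫_{ξ ⊂ η} d_η ξ ∫_{ξᗮ ∩ η} f(ξ + (v + x)) dx`, where `ζ = η + v`, `v ∈ ηᗮ`: the
Radon transform from `k`-planes to `m`-planes. -/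
def radon {k m : ℕ} (f : AffGr k V → ℂ) (ζ : AffGr m V) : ℂ :=
  ∫ ξ : Gr k ζ.dir.sub,
    ∫ x : ↥(ξ.incl.subᗮ ⊓ ζ.dir.sub), f (AffGr.of ξ.incl (ζ.foot + x)) ∂(eucl _)
  ∂(Gr.measure k ζ.dir.sub)

/-- `(R |f|)(ζ)`, as an element of `[0, ∞]`. -/
def radonAbs {k m : ℕ} (f : AffGr k V → ℂ) (ζ : AffGr m V) : ℝ≥0∞ :=
  ∫⁻ ξ : Gr k ζ.dir.sub,
    ∫⁻ x : ↥(ξ.incl.subᗮ ⊓ ζ.dir.sub), ‖f (AffGr.of ξ.incl (ζ.foot + x))‖ₑ ∂(eucl _)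
  ∂(Gr.measure k ζ.dir.sub)

/-- `g_{h,α}(ξ) = ∫_{ξᗮ ∩ h} f(ξ + (y + α)) dy`, for `ξ ⊂ h`. -/
def sliceInt {k : ℕ} (f : AffGr k V → ℂ) (h : Submodule ℝ V) (α : V) (ξ : Gr k h) : ℂ :=
  ∫ y : ↥(ξ.incl.subᗮ ⊓ h), f (AffGr.of ξ.incl (y + α)) ∂(eucl _)

/-- The integral defining `g_{h,α}(ξ)` converges absolutely. -/
def SliceConverges {k : ℕ} (f : AffGr k V → ℂ) (h : Submodule ℝ V) (α : V) (ξ : Gr k h) : Prop :=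
  Integrable (fun y : ↥(ξ.incl.subᗮ ⊓ h) => f (AffGr.of ξ.incl (y + α))) (eucl _)

/-- The identity `∫_{ξ ⊂ η} g_{h,α}(ξ) d_η ξ = ∫_π (R f)(η, v) d_π v`, `π = (ηᗮ ∩ h) + α`, for a
`k'`-dimensional subspace `η` of `h`, with all integrals existing in the Lebesgue sense. The points
of `π` are written as `v = w + α`, `w ∈ ηᗮ ∩ h`. -/
def SliceIdentity {k k' : ℕ} (f : AffGr k V → ℂ) (h : Submodule ℝ V) (α : V) (η : Gr k' h) : Prop :=
  (∀ᵐ ξ ∂(Gr.measure k η.sub), SliceConverges f h α ξ.incl) ∧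
  Integrable (fun ξ : Gr k η.sub => sliceInt f h α ξ.incl) (Gr.measure k η.sub) ∧
  (∀ᵐ w : ↥(η.incl.subᗮ ⊓ h) ∂(eucl _), radonAbs f (AffGr.of η.incl ((w : V) + α)) < ∞) ∧
  Integrable (fun w : ↥(η.incl.subᗮ ⊓ h) => radon f (AffGr.of η.incl ((w : V) + α))) (eucl _) ∧
  funk (sliceInt f h α) η =
    ∫ w : ↥(η.incl.subᗮ ⊓ h), radon f (AffGr.of η.incl ((w : V) + α)) ∂(eucl _)

end RadonGrassmann

end

noncomputable section

namespace RadonGrassmann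

open ProbabilityTheory

variable {V : Type} [NormedAddCommGroup V] [InnerProductSpace ℝ V] [FiniteDimensional ℝ V]
variable {V' : Type} [NormedAddCommGroup V'] [InnerProductSpace ℝ V'] [FiniteDimensional ℝ V']
variable {V'' : Type} [NormedAddCommGroup V''] [InnerProductSpace ℝ V''] [FiniteDimensional ℝ V'']
variable {k m : ℕ}

set_option linter.unusedSectionVars false

/-! ### The orthogonal group and the invariant measure of the Grassmannian -/

section Invariant

/-! The identity is Fubini's theorem for one measure disintegrated in two ways. Fix `h` and `α ∈
hᗮ`, and regard `f` on the `k`-planes in `h + α` as a function `F` on `AffGr k h`. For `η ⊆ h` let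
`AffGr.dirMeasure k η` be the measure on the affine `k`-planes of `h` with direction in `η`. Sorted
by direction `ξ`, its fibres are the volumes of `ξᗮ ∩ h`, and the integral of `F` is the average of
`g_{h,α}` over `ξ ⊆ η`. Since `ξᗮ ∩ h` is the orthogonal sum of `ξᗮ ∩ η` and `ηᗮ ∩ h`, the planes
can also be sorted by the translate of `η` containing them, and then the integral is that of `Rf`
over `π` (`AffGr.dirMeasure_eq_map`, `sliceIdentity_of_integrable`). Hence only integrability of `F`
matters. The measure on `AffGr k h` is the mixture of the `dirMeasure k η` over `η`
(`AffGr.bind_dirMeasure`), so finiteness of `R̃|f|` at a plane gives the identity for almost every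
`η`. In the continuous case the decay of `f` gives integrability for each `η` separately. For the
`L^p` case put `m = k' + κ`; it must be shown that `R̃|f|` is finite almost everywhere, and its
integral over `|ζ| ≤ R` is bounded. Moving the rotations onto `f` leaves an integral over planes
with direction in a fixed `m`-dimensional `W`, weighted by the indicator of a slab around `W`.
Averaging the slab over the rotations fixing `ξ` gives a weight at most `1` and of order
`|u|^{-(n-m)}` (`Gr.exists_slab_le`). By Young's inequality it pairs with `L^p`, since its power `q
= p/(p-1)` is integrable on `ξᗮ` exactly when `p(m-k) < n-k`; for `p = 1` boundedness suffices. -/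

theorem isMulRightInvariant_haarMeasure_top {G : Type*} [Group G] [TopologicalSpace G]
    [IsTopologicalGroup G] [CompactSpace G] [MeasurableSpace G] [BorelSpace G] :
    (Measure.haarMeasure (⊤ : TopologicalSpace.PositiveCompacts G)).IsMulRightInvariant := by
  have h0 : IsProbabilityMeasure (Measure.haarMeasure (⊤ : TopologicalSpace.PositiveCompacts G)) :=
    ⟨Measure.haarMeasure_self⟩
  refine ⟨fun g => ?_⟩
  have : IsProbabilityMeasure
      ((Measure.haarMeasure (⊤ : TopologicalSpace.PositiveCompacts G)).map (· * g)) :=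
    Measure.isProbabilityMeasure_map (measurable_mul_const g).aemeasurable
  -- Right translations commute with left ones, so the translated measure is again a Haar
  -- probability measure, and there is only one.
  exact Measure.isHaarMeasure_eq_of_isProbabilityMeasure _ _

variable [CompleteSpace V]

/-- The normalized Haar measure of the orthogonal group. -/
abbrev orthHaar (V : Type) [NormedAddCommGroup V] [InnerProductSpace ℝ V] [FiniteDimensional ℝ V]
    [CompleteSpace V] : Measure (Orth V) :=
  Measure.haarMeasure (⊤ : TopologicalSpace.PositiveCompacts (Orth V))

instance isProbabilityMeasure_orthHaar : IsProbabilityMeasure (orthHaar V) :=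
  ⟨Measure.haarMeasure_self⟩

instance isMulRightInvariant_orthHaar : (orthHaar V).IsMulRightInvariant :=
  isMulRightInvariant_haarMeasure_top

instance polishSpace_orth : PolishSpace (Orth V) :=
  (isCompact_iff_compactSpace.mpr (inferInstance : CompactSpace (Orth V))).isClosed.polishSpace

theorem Gr.continuous_starProjection :
    Continuous fun W : Gr k V => W.sub.starProjection := continuous_induced_dom

theorem Gr.continuous_rotate_uncurry :
    Continuous fun p : Orth V × Gr k V => Gr.rotate p.1 p.2 := by
  refine continuous_induced_rng.mpr ?_
  have h : (fun W : Gr k V => W.sub.starProjection) ∘ (fun p : Orth V × Gr k V => Gr.rotate p.1 p.2)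
      = fun p : Orth V × Gr k V => p.1.1 * p.2.sub.starProjection * star p.1.1 := by
    funext p; exact Gr.starProjection_rotate p.1 p.2
  rw [h]
  have h1 : Continuous fun p : Orth V × Gr k V => p.1.1 := by fun_prop
  exact (h1.mul (Gr.continuous_starProjection.comp continuous_snd)).mul h1.star

/-- Changing the base point of the orbit is a right translation of the group, which preserves the
Haar measure. The base point can then be chosen to suit each computation, in particular inside a
given subspace. -/
theorem Gr.measure_eq_map (W : Gr k V) :
    Gr.measure k V = (orthHaar V).map fun U => Gr.rotate U W := by
  have hne : Nonempty (Gr k V) := ⟨W⟩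
  rw [Gr.measure, dif_pos hne]
  obtain ⟨U₀, hU₀⟩ := Gr.exists_rotate W hne.some
  conv_rhs => rw [← MeasureTheory.map_mul_right_eq_self (orthHaar V) U₀]
  rw [Measure.map_map (Gr.continuous_rotate _).measurable (measurable_mul_const U₀)]
  congr 1
  funext U
  simp only [Function.comp, Gr.rotate_mul, hU₀]

theorem Gr.measure_eq_zero [IsEmpty (Gr k V)] : Gr.measure k V = 0 :=
  Measure.eq_zero_of_isEmpty _

instance isFiniteMeasure_measure : IsFiniteMeasure (Gr.measure k V) := by
  rcases isEmpty_or_nonempty (Gr k V) with h | ⟨⟨W⟩⟩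
  · rw [Gr.measure_eq_zero]; infer_instance
  · rw [Gr.measure_eq_map W]; infer_instance

theorem Gr.isProbabilityMeasure_of_point (W : Gr k V) : IsProbabilityMeasure (Gr.measure k V) :=
  Gr.isProbabilityMeasure (W.finrank_eq ▸ Submodule.finrank_le W.sub)

theorem Gr.lintegral_measure (W : Gr k V) {φ : Gr k V → ℝ≥0∞} (hφ : Measurable φ) :
    ∫⁻ ξ, φ ξ ∂Gr.measure k V = ∫⁻ U, φ (Gr.rotate U W) ∂orthHaar V := by
  rw [Gr.measure_eq_map W, lintegral_map hφ (Gr.continuous_rotate W).measurable]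

/-- The invariant probability measure on the Grassmannian is unique. -/
theorem Gr.eq_measure_of_invariant (ν : Measure (Gr k V)) [IsProbabilityMeasure ν]
    (hν : ∀ U : Orth V, ν.map (Gr.rotate U) = ν) : ν = Gr.measure k V := by
  refine Measure.ext_of_lintegral _ fun φ hφ => ?_
  have hm : Measurable fun p : Orth V × Gr k V => φ (Gr.rotate p.1 p.2) :=
    hφ.comp Gr.continuous_rotate_uncurry.measurable
  -- Invariance of `ν` allows an average over the group; after the swap, the inner average over the
  -- orbit of `ξ` no longer depends on `ξ`.
  calc ∫⁻ ξ, φ ξ ∂ν = ∫⁻ _ : Orth V, ∫⁻ ξ, φ ξ ∂ν ∂orthHaar V := by simp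
    _ = ∫⁻ U : Orth V, ∫⁻ ξ, φ (Gr.rotate U ξ) ∂ν ∂orthHaar V := by
      refine lintegral_congr fun U => ?_
      conv_lhs => rw [← hν U]
      rw [lintegral_map hφ (Gr.continuous_rotate' U).measurable]
    _ = ∫⁻ ξ, ∫⁻ U : Orth V, φ (Gr.rotate U ξ) ∂orthHaar V ∂ν :=
      lintegral_lintegral_swap hm.aemeasurable
    _ = ∫⁻ _, ∫⁻ ξ, φ ξ ∂Gr.measure k V ∂ν :=
      lintegral_congr fun ξ => (Gr.lintegral_measure ξ hφ).symm
    _ = ∫⁻ ξ, φ ξ ∂Gr.measure k V := by simp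

/-- The orbit map is a continuous surjection from a Polish space onto a second countable T0 space,
so measurability can be tested on the orthogonal group. -/
theorem Gr.measurable_of_comp_rotate {β : Type*} [MeasurableSpace β] (W : Gr k V) {g : Gr k V → β}
    (hg : Measurable fun U : Orth V => g (Gr.rotate U W)) : Measurable g :=
  ((Gr.continuous_rotate W).measurable.measurable_comp_iff_of_surjective
    (fun W' => Gr.exists_rotate W W')).mp hg

end Invariant

/-! ### Isometric images of planes -/

/-- The image of a subspace under a linear isometry. -/
def Gr.map (L : V →ₗᵢ[ℝ] V') (W : Gr k V) : Gr k V' :=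
  ⟨W.sub.map L.toLinearMap, by
    rw [(Submodule.equivMapOfInjective L.toLinearMap L.injective W.sub).symm.finrank_eq]
    exact W.finrank_eq⟩

theorem Gr.map_subtype {h : Submodule ℝ V} (ξ : Gr k h) : ξ.map h.subtypeₗᵢ = ξ.incl := rfl

theorem Gr.map_map (L' : V' →ₗᵢ[ℝ] V'') (L : V →ₗᵢ[ℝ] V') (W : Gr k V) :
    (W.map L).map L' = W.map (L'.comp L) :=
  Gr.ext (Submodule.map_comp _ _ _).symm

theorem Gr.map_id (W : Gr k V) : W.map LinearIsometry.id = W := Gr.ext (Submodule.map_id _)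

theorem Gr.mem_orthogonal_map {L : V →ₗᵢ[ℝ] V'} {W : Gr k V} {u : V} (hu : u ∈ W.subᗮ) :
    L u ∈ (W.map L).subᗮ := by
  rintro _ ⟨w, hw, rfl⟩
  exact (L.inner_map_map w u).trans (hu w hw)

theorem Gr.mem_orthogonal_map_of_range {L : V →ₗᵢ[ℝ] V'} {W : Gr k V} {v : V'}
    (hv : v ∈ (LinearMap.range L.toLinearMap)ᗮ) : v ∈ (W.map L).subᗮ := by
  rintro _ ⟨w, _, rfl⟩
  exact hv _ ⟨w, rfl⟩

theorem Gr.starProjection_map [CompleteSpace V] [CompleteSpace V'] (L : V →ₗᵢ[ℝ] V') (W : Gr k V) :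
    (W.map L).sub.starProjection = L.toContinuousLinearMap.comp
      (W.sub.starProjection.comp (ContinuousLinearMap.adjoint L.toContinuousLinearMap)) := by
  ext x
  apply Submodule.eq_starProjection_of_mem_of_inner_eq_zero
  · exact ⟨_, Submodule.starProjection_apply_mem _ _, rfl⟩
  · rintro _ ⟨w, hw, rfl⟩
    have h1 : inner ℝ x (L w) =
        inner ℝ (ContinuousLinearMap.adjoint L.toContinuousLinearMap x) w :=
      (ContinuousLinearMap.adjoint_inner_left L.toContinuousLinearMap w x).symm
    have h2 := Submodule.starProjection_inner_eq_zero (K := W.sub)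
      (ContinuousLinearMap.adjoint L.toContinuousLinearMap x) w hw
    rw [inner_sub_left] at h2 ⊢
    refine Eq.trans ?_ h2
    change inner ℝ x (L w) - inner ℝ (L _) (L w) = _
    rw [h1, L.inner_map_map]
    rfl

theorem Gr.continuous_map (L : V →ₗᵢ[ℝ] V') : Continuous (Gr.map (k := k) L) := by
  have : CompleteSpace V := FiniteDimensional.complete ℝ V
  have : CompleteSpace V' := FiniteDimensional.complete ℝ V'
  refine continuous_induced_rng.mpr ?_
  have h : (fun W : Gr k V' => W.sub.starProjection) ∘ Gr.map L =
      fun W : Gr k V => L.toContinuousLinearMap.comp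
      (W.sub.starProjection.comp (ContinuousLinearMap.adjoint L.toContinuousLinearMap)) :=
    funext fun W => Gr.starProjection_map L W
  rw [h]
  have := Gr.continuous_starProjection (V := V) (k := k)
  fun_prop

theorem Gr.rotate_eq_map [CompleteSpace V] (U : Orth V) (W : Gr k V) :
    Gr.rotate U W = W.map (Unitary.linearIsometryEquiv U).toLinearIsometry := rfl

theorem AffGr.of_eq_of {ξ : Gr k V} {u u' : V} (h : u - u' ∈ ξ.sub) :
    AffGr.of ξ u = AffGr.of ξ u' := by
  apply AffGr.ext
  refine AffineSubspace.ext_of_direction_eq ?_ ⟨u, AffineSubspace.self_mem_mk' _ _, ?_⟩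
  · simp [AffGr.of]
  · exact AffineSubspace.mem_mk'.mpr h

theorem AffGr.foot_mem (τ : AffGr k V) : τ.foot ∈ τ.dir.subᗮ := by
  have : Nonempty τ.aff := τ.nonempty.to_subtype
  have h := (EuclideanGeometry.coe_orthogonalProjection_eq_iff_mem (s := τ.aff) (p := (0 : V))
    (q := τ.foot)).mp rfl
  have h2 := h.2
  rw [vsub_eq_sub, zero_sub, neg_mem_iff] at h2
  exact h2

theorem AffGr.foot_of_sub_mem (ξ : Gr k V) (u : V) : (AffGr.of ξ u).foot - u ∈ ξ.sub := by
  have : Nonempty (AffGr.of ξ u).aff := (AffGr.of ξ u).nonempty.to_subtype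
  have h : (AffGr.of ξ u).foot ∈ AffineSubspace.mk' u ξ.sub :=
    EuclideanGeometry.orthogonalProjection_mem (s := (AffGr.of ξ u).aff) (0 : V)
  exact AffineSubspace.mem_mk'.mp h

theorem AffGr.isEmbedding_dir_foot :
    IsEmbedding fun τ : AffGr k V => (τ.dir, τ.foot) :=
  ⟨⟨rfl⟩, fun τ τ' h => by
    rw [← AffGr.of_dir_foot τ, ← AffGr.of_dir_foot τ', (Prod.mk.inj h).1, (Prod.mk.inj h).2]⟩

instance t0Space_affGr : T0Space (AffGr k V) := AffGr.isEmbedding_dir_foot.t0Space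

instance t2Space_gr : T2Space (Gr k V) :=
  (IsEmbedding.mk ⟨rfl⟩ (fun W W' h => Gr.ext
    (by simpa using congrArg (fun T : V →L[ℝ] V => T.range) h)) :
      IsEmbedding fun W : Gr k V => W.sub.starProjection).t2Space

instance secondCountableTopology_affGr : SecondCountableTopology (AffGr k V) :=
  AffGr.isEmbedding_dir_foot.secondCountableTopology

theorem AffGr.continuous_dir : Continuous (AffGr.dir : AffGr k V → Gr k V) :=
  continuous_fst.comp AffGr.isEmbedding_dir_foot.continuous

theorem AffGr.continuous_foot : Continuous (AffGr.foot : AffGr k V → V) :=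
  continuous_snd.comp AffGr.isEmbedding_dir_foot.continuous

/-- The image of an affine plane under `x ↦ L x + v`. -/
def AffGr.emb (L : V →ₗᵢ[ℝ] V') (v : V') (τ : AffGr k V) : AffGr k V' :=
  AffGr.of (τ.dir.map L) (L τ.foot + v)

/-- Two points of a plane differ by a vector of its direction, so any point may replace the foot
used in the definition; no orthogonality of `v` is needed here. -/
theorem AffGr.emb_of (L : V →ₗᵢ[ℝ] V') (v : V') (ξ : Gr k V) (u : V) :
    AffGr.emb L v (AffGr.of ξ u) = AffGr.of (ξ.map L) (L u + v) := by
  rw [AffGr.emb, AffGr.dir_of]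
  apply AffGr.of_eq_of
  rw [add_sub_add_right_eq_sub, ← map_sub]
  exact ⟨_, AffGr.foot_of_sub_mem ξ u, rfl⟩

theorem AffGr.emb_emb (L' : V' →ₗᵢ[ℝ] V'') (v' : V'') (L : V →ₗᵢ[ℝ] V') (v : V')
    (τ : AffGr k V) :
    AffGr.emb L' v' (AffGr.emb L v τ) = AffGr.emb (L'.comp L) (L' v + v') τ := by
  rw [AffGr.emb.eq_1 L v, AffGr.emb_of, Gr.map_map, AffGr.emb]
  simp [add_assoc]

theorem AffGr.dir_emb (L : V →ₗᵢ[ℝ] V') (v : V') (τ : AffGr k V) :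
    (AffGr.emb L v τ).dir = τ.dir.map L := AffGr.dir_of _ _

theorem AffGr.add_mem_orthogonal_map (L : V →ₗᵢ[ℝ] V') {v : V'}
    (hv : v ∈ (LinearMap.range L.toLinearMap)ᗮ) (τ : AffGr k V) :
    L τ.foot + v ∈ (τ.dir.map L).subᗮ :=
  Submodule.add_mem _ (Gr.mem_orthogonal_map τ.foot_mem) (Gr.mem_orthogonal_map_of_range hv)

theorem AffGr.foot_emb (L : V →ₗᵢ[ℝ] V') {v : V'} (hv : v ∈ (LinearMap.range L.toLinearMap)ᗮ)
    (τ : AffGr k V) : (AffGr.emb L v τ).foot = L τ.foot + v :=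
  AffGr.foot_of _ _ (AffGr.add_mem_orthogonal_map L hv τ)

/-- The topology is defined through direction and foot. The translation must be orthogonal to the
range for the shifted foot to be the foot of the image. -/
theorem AffGr.continuous_emb_uncurry (L : V →ₗᵢ[ℝ] V') {X : Type*} [TopologicalSpace X]
    {a : X → AffGr k V} {b : X → V'} (ha : Continuous a) (hb : Continuous b)
    (hab : ∀ x, b x ∈ (LinearMap.range L.toLinearMap)ᗮ) :
    Continuous fun x => AffGr.emb L (b x) (a x) :=
  AffGr.continuous_of ((Gr.continuous_map L).comp (AffGr.continuous_dir.comp ha))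
    ((L.continuous.comp (AffGr.continuous_foot.comp ha)).add hb)
    fun x => AffGr.add_mem_orthogonal_map L (hab x) (a x)

theorem AffGr.continuous_emb (L : V →ₗᵢ[ℝ] V') {v : V'}
    (hv : v ∈ (LinearMap.range L.toLinearMap)ᗮ) : Continuous (AffGr.emb (k := k) L v) :=
  AffGr.continuous_emb_uncurry L continuous_id continuous_const fun _ => hv

theorem AffGr.continuous_emb_zero (L : V →ₗᵢ[ℝ] V') : Continuous (AffGr.emb (k := k) L 0) :=
  AffGr.continuous_emb L (Submodule.zero_mem _)

theorem range_subtypeₗᵢ (h : Submodule ℝ V) : LinearMap.range h.subtypeₗᵢ.toLinearMap = h :=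
  Submodule.range_subtype h

theorem AffGr.continuous_emb_subtype {h : Submodule ℝ V} {v : V} (hv : v ∈ hᗮ) :
    Continuous (AffGr.emb (k := k) h.subtypeₗᵢ v) :=
  AffGr.continuous_emb _ (by rwa [range_subtypeₗᵢ])

theorem AffGr.continuous_emb_subtype_uncurry (h : Submodule ℝ V) :
    Continuous fun p : AffGr k h × hᗮ => AffGr.emb h.subtypeₗᵢ (p.2 : V) p.1 :=
  AffGr.continuous_emb_uncurry _ continuous_fst (continuous_subtype_val.comp continuous_snd)
    fun p => by rw [range_subtypeₗᵢ]; exact p.2.2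

/-- The image of an affine plane under an orthogonal transformation. -/
def AffGr.rotate [CompleteSpace V] (U : Orth V) (τ : AffGr k V) : AffGr k V :=
  AffGr.emb (Unitary.linearIsometryEquiv U).toLinearIsometry 0 τ

theorem AffGr.rotate_of [CompleteSpace V] (U : Orth V) (ξ : Gr k V) (u : V) :
    AffGr.rotate U (AffGr.of ξ u) = AffGr.of (Gr.rotate U ξ) (U.1 u) := by
  rw [AffGr.rotate, AffGr.emb_of, add_zero]; rfl

theorem AffGr.dir_rotate [CompleteSpace V] (U : Orth V) (τ : AffGr k V) :
    (AffGr.rotate U τ).dir = Gr.rotate U τ.dir := AffGr.dir_emb _ _ _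

theorem AffGr.foot_rotate [CompleteSpace V] (U : Orth V) (τ : AffGr k V) :
    (AffGr.rotate U τ).foot = U.1 τ.foot := by
  rw [AffGr.rotate, AffGr.foot_emb _ (Submodule.zero_mem _), add_zero]; rfl

theorem AffGr.rotate_mul [CompleteSpace V] (U U' : Orth V) (τ : AffGr k V) :
    AffGr.rotate (U * U') τ = AffGr.rotate U (AffGr.rotate U' τ) := by
  rw [← AffGr.of_dir_foot τ, AffGr.rotate_of, AffGr.rotate_of, AffGr.rotate_of, Gr.rotate_mul]
  rfl

theorem AffGr.continuous_rotate_uncurry [CompleteSpace V] :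
    Continuous fun p : Orth V × AffGr k V => AffGr.rotate p.1 p.2 := by
  have h0 : Continuous fun p : Orth V × AffGr k V => p.1.1 := by fun_prop
  have h1 : Continuous fun p : Orth V × AffGr k V => p.1.1 (p.2.foot) :=
    h0.clm_apply (AffGr.continuous_foot.comp continuous_snd)
  have h2 : Continuous fun p : Orth V × AffGr k V => Gr.rotate p.1 p.2.dir :=
    Gr.continuous_rotate_uncurry.comp
      (continuous_fst.prodMk (AffGr.continuous_dir.comp continuous_snd))
  rw [AffGr.isEmbedding_dir_foot.continuous_iff]
  have h3 : ((fun τ : AffGr k V => (τ.dir, τ.foot)) ∘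
      fun p : Orth V × AffGr k V => AffGr.rotate p.1 p.2) =
      fun p : Orth V × AffGr k V => (Gr.rotate p.1 p.2.dir, p.1.1 (p.2.foot)) :=
    funext fun p => Prod.ext (AffGr.dir_rotate _ _) (AffGr.foot_rotate _ _)
  rw [h3]
  exact h2.prodMk h1

theorem AffGr.continuous_rotate_comp [CompleteSpace V] {X : Type*} [TopologicalSpace X]
    {a : X → Orth V} {b : X → AffGr k V} (ha : Continuous a) (hb : Continuous b) :
    Continuous fun x => AffGr.rotate (a x) (b x) := by
  have h := AffGr.continuous_rotate_uncurry.comp (ha.prodMk hb)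
  exact h.congr fun _ => rfl

theorem AffGr.continuous_rotate [CompleteSpace V] (U : Orth V) :
    Continuous fun τ : AffGr k V => AffGr.rotate U τ :=
  AffGr.continuous_emb_zero _

/-- The parametrization by `Orth V × Wᗮ` transfers measurability and compactness questions from the
affine Grassmannian to a product. -/
theorem AffGr.exists_rotate [CompleteSpace V] (W : Gr k V) (τ : AffGr k V) :
    ∃ (U : Orth V) (u : W.subᗮ), AffGr.rotate U (AffGr.of W u) = τ := by
  obtain ⟨U, hU⟩ := Gr.exists_rotate W τ.dir
  have h := τ.foot_mem
  rw [← hU, Gr.orthogonal_rotate] at h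
  obtain ⟨u, hu, huf⟩ := h
  refine ⟨U, ⟨u, hu⟩, ?_⟩
  have huf' : U.1 u = τ.foot := huf
  rw [AffGr.rotate_of, hU, huf', AffGr.of_dir_foot]

/-! ### Measures on isometric images -/

section Measures

variable [MeasurableSpace V] [BorelSpace V] [MeasurableSpace V'] [BorelSpace V']

instance sigmaFinite_eucl (W : Submodule ℝ V) : SigmaFinite (eucl W) := by
  unfold eucl; infer_instance

theorem map_eucl {W : Submodule ℝ V} {W' : Submodule ℝ V'} (e : W ≃ₗᵢ[ℝ] W') :
    (eucl W).map e = eucl W' :=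
  e.measurePreserving.map_eq

theorem map_eucl_prod {V₁ V₂ : Type} [NormedAddCommGroup V₁] [InnerProductSpace ℝ V₁]
    [FiniteDimensional ℝ V₁] [MeasurableSpace V₁] [BorelSpace V₁]
    [NormedAddCommGroup V₂] [InnerProductSpace ℝ V₂]
    [FiniteDimensional ℝ V₂] [MeasurableSpace V₂] [BorelSpace V₂]
    {A : Submodule ℝ V₁} {B : Submodule ℝ V₂} {C : Submodule ℝ V}
    (e : WithLp 2 (A × B) ≃ₗᵢ[ℝ] C) :
    ((eucl A).prod (eucl B)).map (fun p => e (WithLp.toLp 2 p)) = eucl C := by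
  let _ : MeasureSpace A := measureSpaceOfInnerProductSpace
  let _ : MeasureSpace B := measureSpaceOfInnerProductSpace
  let _ : MeasureSpace C := measureSpaceOfInnerProductSpace
  exact (e.measurePreserving.comp (WithLp.volume_preserving_toLp A B)).map_eq

/-- The foot inverts the parametrization, and the image is the closed set of planes with direction
`ξ`. Being an embedding, it yields integral formulas over the fibre for arbitrary functions,
measurable or not. -/
theorem AffGr.isClosedEmbedding_of (ξ : Gr k V) :
    IsClosedEmbedding fun u : ξ.subᗮ => AffGr.of ξ (u : V) := by
  have hc : Continuous fun u : ξ.subᗮ => AffGr.of ξ (u : V) :=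
    AffGr.continuous_of continuous_const continuous_subtype_val fun x => x.2
  have hr : Set.range (fun u : ξ.subᗮ => AffGr.of ξ (u : V)) = AffGr.dir ⁻¹' {ξ} := by
    ext τ
    constructor
    · rintro ⟨u, rfl⟩
      exact AffGr.dir_of _ _
    · intro hτ
      have hτ' : τ.dir = ξ := hτ
      refine ⟨⟨τ.foot, hτ' ▸ τ.foot_mem⟩, ?_⟩
      change AffGr.of ξ τ.foot = τ
      rw [← hτ', AffGr.of_dir_foot]
  refine ⟨?_, hr ▸ (isClosed_singleton.preimage AffGr.continuous_dir)⟩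
  have hc' : Continuous fun τ : AffGr k V => ξ.subᗮ.orthogonalProjectionOnto τ.foot :=
    (ContinuousLinearMap.continuous _).comp AffGr.continuous_foot
  refine Topology.IsEmbedding.of_leftInverse
    (f := fun τ : AffGr k V => ξ.subᗮ.orthogonalProjectionOnto τ.foot) (fun u => ?_) hc' hc
  simp [AffGr.foot_of ξ u u.2]

theorem AffGr.measurableEmbedding_of (ξ : Gr k V) :
    MeasurableEmbedding fun u : ξ.subᗮ => AffGr.of ξ (u : V) :=
  (AffGr.isClosedEmbedding_of ξ).measurableEmbedding

instance sFinite_fibre (ξ : Gr k V) : SFinite (AffGr.fibre ξ) := by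
  unfold AffGr.fibre; infer_instance

theorem AffGr.lintegral_fibre (ξ : Gr k V) (φ : AffGr k V → ℝ≥0∞) :
    ∫⁻ τ, φ τ ∂AffGr.fibre ξ = ∫⁻ u : ξ.subᗮ, φ (AffGr.of ξ (u : V)) ∂eucl ξ.subᗮ :=
  (AffGr.measurableEmbedding_of ξ).lintegral_map _

theorem AffGr.integral_fibre (ξ : Gr k V) (φ : AffGr k V → ℂ) :
    ∫ τ, φ τ ∂AffGr.fibre ξ = ∫ u : ξ.subᗮ, φ (AffGr.of ξ (u : V)) ∂eucl ξ.subᗮ :=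
  (AffGr.measurableEmbedding_of ξ).integral_map _

theorem AffGr.integrable_fibre (ξ : Gr k V) (φ : AffGr k V → ℂ) :
    Integrable φ (AffGr.fibre ξ) ↔
      Integrable (fun u : ξ.subᗮ => φ (AffGr.of ξ (u : V))) (eucl ξ.subᗮ) :=
  (AffGr.measurableEmbedding_of ξ).integrable_map_iff

/-- The isometry of orthogonal complements induced by an isometry. -/
def Gr.orthogonalEquiv (e : V ≃ₗᵢ[ℝ] V') (ξ : Gr k V) :
    ξ.subᗮ ≃ₗᵢ[ℝ] (ξ.map e.toLinearIsometry).subᗮ :=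
  (e.submoduleMap ξ.subᗮ).trans (LinearIsometryEquiv.ofEq _ _
    (Submodule.map_orthogonal_equiv ξ.sub e))

theorem AffGr.map_emb_fibre (e : V ≃ₗᵢ[ℝ] V') (ξ : Gr k V) :
    (AffGr.fibre ξ).map (AffGr.emb e.toLinearIsometry 0) =
      AffGr.fibre (ξ.map e.toLinearIsometry) := by
  rw [AffGr.fibre, AffGr.fibre, ← map_eucl (Gr.orthogonalEquiv e ξ),
    Measure.map_map (AffGr.continuous_emb_zero _).measurable (measurableEmbedding_of ξ).measurable,
    Measure.map_map (measurableEmbedding_of _).measurable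
      (Gr.orthogonalEquiv e ξ).continuous.measurable]
  congr 1
  funext u
  simp only [Function.comp, AffGr.emb_of, add_zero]
  rfl

theorem AffGr.map_rotate_fibre [CompleteSpace V] (U : Orth V) (ξ : Gr k V) :
    (AffGr.fibre ξ).map (AffGr.rotate U) = AffGr.fibre (Gr.rotate U ξ) :=
  AffGr.map_emb_fibre _ ξ

/-- For `ξ ⊆ h`, the orthogonal complement of `ξ` is the orthogonal sum of `ξᗮ ∩ h` and `hᗮ`. -/
def Gr.orthogonalSum (h : Submodule ℝ V) (ξ : Gr k h) :
    WithLp 2 (ξ.subᗮ × hᗮ) ≃ₗᵢ[ℝ] ξ.incl.subᗮ :=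
  let L : WithLp 2 (ξ.subᗮ × hᗮ) →ₗ[ℝ] ξ.incl.subᗮ :=
    { toFun := fun p => ⟨((p.ofLp.1 : h) : V) + (p.ofLp.2 : V), Submodule.add_mem _
        (Gr.mem_orthogonal_map (L := h.subtypeₗᵢ) p.ofLp.1.2)
        (Gr.mem_orthogonal_map_of_range (L := h.subtypeₗᵢ)
          (by rw [range_subtypeₗᵢ]; exact p.ofLp.2.2))⟩
      map_add' := fun p q => by ext; simp; abel
      map_smul' := fun c p => by ext; simp }
  LinearIsometryEquiv.ofSurjective
    { toLinearMap := L
      norm_map' := fun p => by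
        have h1 : inner ℝ ((p.ofLp.1 : h) : V) (p.ofLp.2 : V) = 0 :=
          p.ofLp.2.2 _ (p.ofLp.1 : h).2
        have h2 := norm_add_sq_eq_norm_sq_add_norm_sq_real h1
        have h3 := WithLp.prod_norm_sq_eq_of_L2 p
        change ‖((p.ofLp.1 : h) : V) + (p.ofLp.2 : V)‖ = _
        rw [← sq_eq_sq₀ (norm_nonneg _) (norm_nonneg _), h3, sq, h2, sq, sq]
        rfl } (by
    rintro ⟨y, hy⟩
    have hm : h.orthogonalProjectionOnto y ∈ ξ.subᗮ := by
      intro w hw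
      have h1 : inner ℝ ((w : h) : V) y = 0 := hy _ ⟨w, hw, rfl⟩
      rw [Submodule.inner_orthogonalProjectionOnto_eq_of_mem_left]
      exact h1
    refine ⟨WithLp.toLp 2 (⟨_, hm⟩, ⟨y - h.starProjection y,
      Submodule.sub_starProjection_mem_orthogonal y⟩), ?_⟩
    ext
    change (h.orthogonalProjectionOnto y : V) + (y - h.starProjection y) = y
    rw [Submodule.starProjection_apply]
    abel)

theorem Gr.orthogonalSum_apply (h : Submodule ℝ V) (ξ : Gr k h) (p : ξ.subᗮ × hᗮ) :
    (Gr.orthogonalSum h ξ (WithLp.toLp 2 p) : V) = ((p.1 : h) : V) + (p.2 : V) := rfl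

/-- By Pythagoras, a foot in `ξᗮ` splits into a foot inside `h` and a translation in `hᗮ`. This
splitting is the source of the second disintegration. -/
theorem AffGr.fibre_incl (h : Submodule ℝ V) (ξ : Gr k h) :
    AffGr.fibre ξ.incl =
      ((AffGr.fibre ξ).prod (eucl hᗮ)).map fun p => AffGr.emb h.subtypeₗᵢ (p.2 : V) p.1 := by
  have hm : Measurable fun p : AffGr k h × hᗮ => AffGr.emb h.subtypeₗᵢ (p.2 : V) p.1 :=
    (AffGr.continuous_emb_subtype_uncurry h).measurable
  have hs : Measurable fun p : ξ.subᗮ × hᗮ => Gr.orthogonalSum h ξ (WithLp.toLp 2 p) :=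
    ((Gr.orthogonalSum h ξ).continuous.comp
      (WithLp.prod_continuous_toLp 2 _ _)).measurable
  have h1 : (AffGr.fibre ξ).prod (eucl hᗮ) = ((eucl ξ.subᗮ).prod (eucl hᗮ)).map
      (Prod.map (fun u : ξ.subᗮ => AffGr.of ξ (u : h)) id) := by
    rw [← Measure.map_prod_map _ _ (measurableEmbedding_of ξ).measurable measurable_id,
      Measure.map_id]
    rfl
  rw [h1, Measure.map_map hm ((measurableEmbedding_of ξ).measurable.prodMap measurable_id),
    AffGr.fibre, ← map_eucl_prod (Gr.orthogonalSum h ξ),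
    Measure.map_map (measurableEmbedding_of _).measurable hs]
  congr 1
  funext p
  simp only [Function.comp, Prod.map, AffGr.emb_of, Gr.orthogonalSum_apply, id]
  rfl

theorem Gr.map_measure [CompleteSpace V] [CompleteSpace V'] (e : V ≃ₗᵢ[ℝ] V') :
    (Gr.measure k V).map (Gr.map e.toLinearIsometry) = Gr.measure k V' := by
  rcases isEmpty_or_nonempty (Gr k V) with hV | ⟨⟨W⟩⟩
  · have : IsEmpty (Gr k V') := ⟨fun W => hV.elim (W.map e.symm.toLinearIsometry)⟩
    rw [Gr.measure_eq_zero, Gr.measure_eq_zero, Measure.map_zero]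
  have := Gr.isProbabilityMeasure_of_point W
  have hm := (Gr.continuous_map (k := k) e.toLinearIsometry).measurable
  have : IsProbabilityMeasure ((Gr.measure k V).map (Gr.map e.toLinearIsometry)) :=
    Measure.isProbabilityMeasure_map hm.aemeasurable
  refine Gr.eq_measure_of_invariant _ fun U => ?_
  -- The image measure is identified by uniqueness: a rotation of `V'` pulls back under `e` to its
  -- conjugate `U₀` on `V`.
  let U₀ : Orth V := Unitary.linearIsometryEquiv.symm
    ((e.trans (Unitary.linearIsometryEquiv U)).trans e.symm)
  conv_rhs => rw [← Gr.map_rotate_measure U₀]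
  rw [Measure.map_map (Gr.continuous_rotate' U).measurable hm,
    Measure.map_map hm (Gr.continuous_rotate' U₀).measurable]
  congr 1
  funext ξ
  simp only [Function.comp, Gr.rotate_eq_map, Gr.map_map]
  congr 1
  ext x
  simp [U₀]

theorem AffGr.lintegral_measure [CompleteSpace V] {φ : AffGr k V → ℝ≥0∞} (hφ : Measurable φ) :
    ∫⁻ τ, φ τ ∂AffGr.measure k V = ∫⁻ ξ, ∫⁻ τ, φ τ ∂AffGr.fibre ξ ∂Gr.measure k V :=
  Measure.lintegral_bind AffGr.measurable_fibre.aemeasurable hφ.aemeasurable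

theorem AffGr.measurable_lintegral_fibre [CompleteSpace V] {φ : AffGr k V → ℝ≥0∞}
    (hφ : Measurable φ) : Measurable fun ξ : Gr k V => ∫⁻ τ, φ τ ∂AffGr.fibre ξ :=
  (Measure.measurable_lintegral hφ).comp AffGr.measurable_fibre

theorem AffGr.map_measure [CompleteSpace V] [CompleteSpace V'] (e : V ≃ₗᵢ[ℝ] V') :
    (AffGr.measure k V).map (AffGr.emb e.toLinearIsometry 0) = AffGr.measure k V' := by
  have hm := (AffGr.continuous_emb_zero (k := k) e.toLinearIsometry).measurable
  refine Measure.ext_of_lintegral _ fun φ hφ => ?_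
  have hc : Measurable fun τ => φ (AffGr.emb e.toLinearIsometry 0 τ) := hφ.comp hm
  rw [lintegral_map hφ hm, AffGr.lintegral_measure hc, AffGr.lintegral_measure hφ,
    ← Gr.map_measure e, lintegral_map (AffGr.measurable_lintegral_fibre hφ)
      (Gr.continuous_map _).measurable]
  refine lintegral_congr fun ξ => ?_
  rw [← AffGr.map_emb_fibre, lintegral_map hφ hm]

theorem AffGr.measure_eq_map [CompleteSpace V] (W : Gr k V) :
    AffGr.measure k V =
      ((orthHaar V).prod (AffGr.fibre W)).map fun p => AffGr.rotate p.1 p.2 := by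
  have hm := (AffGr.continuous_rotate_uncurry (V := V) (k := k)).measurable
  refine Measure.ext_of_lintegral _ fun φ hφ => ?_
  have hc : Measurable fun p : Orth V × AffGr k V => φ (AffGr.rotate p.1 p.2) := hφ.comp hm
  rw [lintegral_map hφ hm, AffGr.lintegral_measure hφ, lintegral_prod _ hc.aemeasurable,
    Gr.lintegral_measure W (AffGr.measurable_lintegral_fibre hφ)]
  refine lintegral_congr fun U => ?_
  rw [← AffGr.map_rotate_fibre, lintegral_map hφ (AffGr.continuous_rotate U).measurable]

instance sFinite_affMeasure [CompleteSpace V] : SFinite (AffGr.measure k V) := by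
  rcases isEmpty_or_nonempty (Gr k V) with hV | ⟨⟨W⟩⟩
  · have : IsEmpty (AffGr k V) := ⟨fun τ => hV.elim τ.dir⟩
    rw [Measure.eq_zero_of_isEmpty (AffGr.measure k V)]
    infer_instance
  · rw [AffGr.measure_eq_map W]; infer_instance

theorem AffGr.lintegral_measure_eq [CompleteSpace V] (W : Gr k V) {φ : AffGr k V → ℝ≥0∞}
    (hφ : Measurable φ) : ∫⁻ τ, φ τ ∂AffGr.measure k V =
      ∫⁻ U, ∫⁻ τ, φ (AffGr.rotate U τ) ∂AffGr.fibre W ∂orthHaar V := by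
  have hm := (AffGr.continuous_rotate_uncurry (V := V) (k := k)).measurable
  have hc : Measurable fun p : Orth V × AffGr k V => φ (AffGr.rotate p.1 p.2) := hφ.comp hm
  rw [AffGr.measure_eq_map W, lintegral_map hφ hm, lintegral_prod _ hc.aemeasurable]

end Measures

/-! ### Averaging over the planes contained in a subspace -/

section Averages

variable [CompleteSpace V] [MeasurableSpace V] [BorelSpace V]

/-- The isometry between a subspace and its image. -/
def Gr.subEquiv (L : V →ₗᵢ[ℝ] V') (η : Gr m V) : η.sub ≃ₗᵢ[ℝ] (η.map L).sub :=
  LinearIsometryEquiv.ofSurjective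
    { toLinearMap := L.toLinearMap.submoduleMap η.sub
      norm_map' := fun x => L.norm_map x }
    (L.toLinearMap.submoduleMap_surjective η.sub)

theorem Gr.incl_map_subEquiv (L : V →ₗᵢ[ℝ] V') (η : Gr m V) (ξ : Gr k η.sub) :
    (ξ.map (Gr.subEquiv L η).toLinearIsometry).incl = ξ.incl.map L := by
  rw [← Gr.map_subtype, ← Gr.map_subtype, Gr.map_map, Gr.map_map]
  rfl

theorem AffGr.emb_emb_subEquiv (L : V →ₗᵢ[ℝ] V') (η : Gr m V) (w : V) (α : V')
    (τ : AffGr k η.sub) :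
    AffGr.emb (η.map L).sub.subtypeₗᵢ (L w + α)
      (AffGr.emb (Gr.subEquiv L η).toLinearIsometry 0 τ) =
    AffGr.emb L α (AffGr.emb η.sub.subtypeₗᵢ w τ) := by
  rw [AffGr.emb_emb, AffGr.emb_emb, map_zero, zero_add]
  rfl

theorem Gr.continuous_incl {h : Submodule ℝ V} : Continuous (Gr.incl : Gr k h → Gr k V) :=
  Gr.continuous_map h.subtypeₗᵢ

/-- The invariant probability measure on the `k`-dimensional subspaces of `h`, as a measure on the
subspaces of the ambient space. -/
def Gr.inclMeasure (k : ℕ) (h : Submodule ℝ V) : Measure (Gr k V) :=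
  (Gr.measure k h).map Gr.incl

theorem Gr.inclMeasure_rotate (U : Orth V) (η : Gr m V) :
    Gr.inclMeasure k (Gr.rotate U η).sub = (Gr.inclMeasure k η.sub).map (Gr.rotate U) := by
  let L := (Unitary.linearIsometryEquiv U).toLinearIsometry
  change Gr.inclMeasure k (η.map L).sub = _
  rw [Gr.inclMeasure, Gr.inclMeasure, ← Gr.map_measure (Gr.subEquiv L η),
    Measure.map_map Gr.continuous_incl.measurable (Gr.continuous_map _).measurable,
    Measure.map_map (Gr.continuous_rotate' U).measurable Gr.continuous_incl.measurable]
  congr 1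
  funext ξ
  exact Gr.incl_map_subEquiv L η ξ

/-- Along the orbit of `W` the measures are rotated copies of a single one
(`Gr.inclMeasure_rotate`), which reduces the claim to measurability of sections in a product. -/
theorem Gr.measurable_inclMeasure : Measurable fun η : Gr m V => Gr.inclMeasure k η.sub := by
  rcases isEmpty_or_nonempty (Gr m V) with h | ⟨⟨W⟩⟩
  · exact measurable_of_empty _
  refine Gr.measurable_of_comp_rotate W (Measure.measurable_of_measurable_coe _ fun s hs => ?_)
  have hm : Measurable fun p : Orth V × Gr k W.sub => Gr.rotate p.1 p.2.incl :=
    (Gr.continuous_rotate_uncurry.comp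
      (continuous_fst.prodMk (Gr.continuous_incl.comp continuous_snd))).measurable
  convert measurable_measure_prodMk_left (ν := Gr.measure k W.sub) (hm hs) using 1
  funext U
  rw [Gr.inclMeasure_rotate, Gr.inclMeasure,
    Measure.map_map (Gr.continuous_rotate' U).measurable Gr.continuous_incl.measurable,
    Measure.map_apply ((Gr.continuous_rotate' U).measurable.comp Gr.continuous_incl.measurable) hs]
  rfl

/-- Averaging over the subspaces of `η` and then over `η` is averaging over all subspaces. -/
theorem Gr.bind_inclMeasure (η₀ : Gr m V) (ξ₀ : Gr k η₀.sub) :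
    (Gr.measure m V).bind (fun η => Gr.inclMeasure k η.sub) = Gr.measure k V := by
  refine Measure.ext_of_lintegral _ fun φ hφ => ?_
  have := Gr.isProbabilityMeasure_of_point ξ₀
  have hm : Measurable fun p : Orth V × Gr k η₀.sub => φ (Gr.rotate p.1 p.2.incl) :=
    hφ.comp (Gr.continuous_rotate_uncurry.comp
      (continuous_fst.prodMk (Gr.continuous_incl.comp continuous_snd))).measurable
  have hi : Measurable fun η : Gr m V => ∫⁻ ξ, φ ξ ∂Gr.inclMeasure k η.sub :=
    (Measure.measurable_lintegral hφ).comp Gr.measurable_inclMeasure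
  rw [Measure.lintegral_bind Gr.measurable_inclMeasure.aemeasurable hφ.aemeasurable,
    Gr.lintegral_measure η₀ hi]
  calc ∫⁻ U, ∫⁻ ξ, φ ξ ∂Gr.inclMeasure k (Gr.rotate U η₀).sub ∂orthHaar V
      = ∫⁻ U, ∫⁻ ξ : Gr k η₀.sub, φ (Gr.rotate U ξ.incl) ∂Gr.measure k η₀.sub ∂orthHaar V := by
        refine lintegral_congr fun U => ?_
        have hU : Measurable fun ξ : Gr k V => φ (Gr.rotate U ξ) :=
          hφ.comp (Gr.continuous_rotate' U).measurable
        rw [Gr.inclMeasure_rotate, lintegral_map hφ (Gr.continuous_rotate' U).measurable,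
          Gr.inclMeasure, lintegral_map hU Gr.continuous_incl.measurable]
    _ = ∫⁻ ξ : Gr k η₀.sub, ∫⁻ U, φ (Gr.rotate U ξ.incl) ∂orthHaar V ∂Gr.measure k η₀.sub :=
        lintegral_lintegral_swap hm.aemeasurable
    _ = ∫⁻ _ : Gr k η₀.sub, ∫⁻ ξ, φ ξ ∂Gr.measure k V ∂Gr.measure k η₀.sub :=
        lintegral_congr fun ξ => (Gr.lintegral_measure ξ.incl hφ).symm
    _ = ∫⁻ ξ, φ ξ ∂Gr.measure k V := by simp

theorem AffGr.measurable_fibre_incl {h : Submodule ℝ V} :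
    Measurable fun ξ : Gr k h => AffGr.fibre ξ.incl :=
  AffGr.measurable_fibre.comp Gr.continuous_incl.measurable

/-- The measure on affine planes whose direction is contained in `h`. -/
def AffGr.dirMeasure (k : ℕ) (h : Submodule ℝ V) : Measure (AffGr k V) :=
  (Gr.inclMeasure k h).bind AffGr.fibre

theorem AffGr.measurable_dirMeasure :
    Measurable fun η : Gr m V => AffGr.dirMeasure k η.sub :=
  (Measure.measurable_bind' AffGr.measurable_fibre).comp Gr.measurable_inclMeasure

/-- Applied inside `h`, this turns integrability over all `k`-planes into integrability over those
with direction in `η`, for almost every `η`. -/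
theorem AffGr.bind_dirMeasure (η₀ : Gr m V) (ξ₀ : Gr k η₀.sub) :
    (Gr.measure m V).bind (fun η => AffGr.dirMeasure k η.sub) = AffGr.measure k V := by
  rw [AffGr.measure, ← Gr.bind_inclMeasure η₀ ξ₀, Measure.bind_bind
    Gr.measurable_inclMeasure.aemeasurable AffGr.measurable_fibre.aemeasurable]
  rfl

theorem AffGr.dirMeasure_eq_bind (h : Submodule ℝ V) :
    AffGr.dirMeasure k h = (Gr.measure k h).bind fun ξ => AffGr.fibre ξ.incl := by
  ext s hs
  have h1 : Measurable fun ξ : Gr k V => AffGr.fibre ξ s :=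
    (Measure.measurable_coe hs).comp AffGr.measurable_fibre
  rw [AffGr.dirMeasure, Measure.bind_apply hs AffGr.measurable_fibre.aemeasurable,
    Gr.inclMeasure, lintegral_map h1 Gr.continuous_incl.measurable,
    Measure.bind_apply hs AffGr.measurable_fibre_incl.aemeasurable]

theorem AffGr.lintegral_dirMeasure (h : Submodule ℝ V) {φ : AffGr k V → ℝ≥0∞}
    (hφ : Measurable φ) : ∫⁻ τ, φ τ ∂AffGr.dirMeasure k h =
      ∫⁻ ξ : Gr k h, ∫⁻ τ, φ τ ∂AffGr.fibre ξ.incl ∂Gr.measure k h := by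
  rw [AffGr.dirMeasure_eq_bind,
    Measure.lintegral_bind AffGr.measurable_fibre_incl.aemeasurable hφ.aemeasurable]

/-- The counterpart of `AffGr.dirMeasure_eq_bind`: there the planes are sorted by direction, here by
the translate of `h` that contains them. Equating the two proves the slice identity. -/
theorem AffGr.dirMeasure_eq_map (h : Submodule ℝ V) :
    AffGr.dirMeasure k h = ((AffGr.measure k h).prod (eucl hᗮ)).map
      fun p => AffGr.emb h.subtypeₗᵢ (p.2 : V) p.1 := by
  have hm : Measurable fun p : AffGr k h × hᗮ => AffGr.emb h.subtypeₗᵢ (p.2 : V) p.1 :=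
    (AffGr.continuous_emb_subtype_uncurry h).measurable
  refine Measure.ext_of_lintegral _ fun φ hφ => ?_
  have hc : Measurable fun p : AffGr k h × hᗮ => φ (AffGr.emb h.subtypeₗᵢ (p.2 : V) p.1) :=
    hφ.comp hm
  rw [AffGr.lintegral_dirMeasure h hφ, lintegral_map hφ hm, lintegral_prod _ hc.aemeasurable,
    AffGr.lintegral_measure hc.lintegral_prod_right']
  refine lintegral_congr fun ξ => ?_
  rw [AffGr.fibre_incl, lintegral_map hφ hm, lintegral_prod _ hc.aemeasurable]

/-- The measure on the affine `k`-planes contained in `h + α`. -/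
def AffGr.subMeasure (k : ℕ) (h : Submodule ℝ V) (α : V) : Measure (AffGr k V) :=
  (AffGr.measure k h).map (AffGr.emb h.subtypeₗᵢ α)

theorem AffGr.subMeasure_rotate (U : Orth V) (η : Gr m V) {α : V} (hα : α ∈ η.subᗮ) :
    AffGr.subMeasure k (Gr.rotate U η).sub (U.1 α) =
      (AffGr.subMeasure k η.sub α).map (AffGr.rotate U) := by
  let L := (Unitary.linearIsometryEquiv U).toLinearIsometry
  change AffGr.subMeasure k (η.map L).sub (L α) = _
  have hα' : L α ∈ (η.map L).subᗮ := Gr.mem_orthogonal_map hα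
  rw [AffGr.subMeasure, AffGr.subMeasure, ← AffGr.map_measure (Gr.subEquiv L η),
    Measure.map_map (AffGr.continuous_emb_subtype hα').measurable
      (AffGr.continuous_emb_zero _).measurable,
    Measure.map_map (AffGr.continuous_rotate U).measurable
      (AffGr.continuous_emb_subtype hα).measurable]
  congr 1
  funext τ
  have := AffGr.emb_emb_subEquiv L η α 0 τ
  rw [add_zero] at this
  exact this

theorem AffGr.subMeasure_dir_rotate (U : Orth V) (ζ : AffGr m V) :
    AffGr.subMeasure k (AffGr.rotate U ζ).dir.sub (AffGr.rotate U ζ).foot =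
      (AffGr.subMeasure k ζ.dir.sub ζ.foot).map (AffGr.rotate U) := by
  rw [AffGr.dir_rotate, AffGr.foot_rotate, AffGr.subMeasure_rotate U _ ζ.foot_mem]

theorem AffGr.lintegral_subMeasure {h : Submodule ℝ V} {α : V} (hα : α ∈ hᗮ)
    {φ : AffGr k V → ℝ≥0∞} (hφ : Measurable φ) : ∫⁻ τ, φ τ ∂AffGr.subMeasure k h α =
      ∫⁻ σ, φ (AffGr.emb h.subtypeₗᵢ α σ) ∂AffGr.measure k h :=
  lintegral_map hφ (AffGr.continuous_emb_subtype hα).measurable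

theorem AffGr.continuous_rotate_emb (W : Gr m V) :
    Continuous fun p : (Orth V × W.subᗮ) × AffGr k W.sub =>
      AffGr.rotate p.1.1 (AffGr.emb W.sub.subtypeₗᵢ (p.1.2 : V) p.2) := by
  have h1 : Continuous fun p : (Orth V × W.subᗮ) × AffGr k W.sub =>
      AffGr.emb W.sub.subtypeₗᵢ (p.1.2 : V) p.2 :=
    AffGr.continuous_emb_uncurry _ continuous_snd
      (continuous_subtype_val.comp (continuous_snd.comp continuous_fst))
      fun p => by rw [range_subtypeₗᵢ]; exact p.1.2.2
  exact AffGr.continuous_rotate_comp (continuous_fst.comp continuous_fst) h1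

/-- As for the compact Grassmannian, equivariance reduces the claim to a product, now with
parameters `(U, u) ∈ Orth V × Wᗮ`. -/
theorem AffGr.measurable_subMeasure :
    Measurable fun ζ : AffGr m V => AffGr.subMeasure k ζ.dir.sub ζ.foot := by
  rcases isEmpty_or_nonempty (Gr m V) with h | ⟨⟨W⟩⟩
  · have : IsEmpty (AffGr m V) := ⟨fun τ => h.elim τ.dir⟩
    exact measurable_of_empty _
  have hF : Measurable fun p : Orth V × W.subᗮ => AffGr.rotate p.1 (AffGr.of W (p.2 : V)) :=
    (AffGr.continuous_rotate_comp continuous_fst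
      ((AffGr.isClosedEmbedding_of W).continuous.comp continuous_snd)).measurable
  have hs : Function.Surjective
      fun p : Orth V × W.subᗮ => AffGr.rotate p.1 (AffGr.of W (p.2 : V)) := fun τ => by
    obtain ⟨U, u, h⟩ := AffGr.exists_rotate W τ
    exact ⟨(U, u), h⟩
  rw [← hF.measurable_comp_iff_of_surjective hs]
  refine Measure.measurable_of_measurable_coe _ fun s hs => ?_
  have hm := (AffGr.continuous_rotate_emb (k := k) W).measurable
  convert measurable_measure_prodMk_left (ν := AffGr.measure k W.sub) (hm hs) using 1
  funext p
  simp only [Function.comp]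
  rw [AffGr.subMeasure_dir_rotate, AffGr.dir_of, AffGr.foot_of _ _ p.2.2, AffGr.subMeasure,
    Measure.map_map (AffGr.continuous_rotate p.1).measurable
      (AffGr.continuous_emb_subtype p.2.2).measurable,
    Measure.map_apply ((AffGr.continuous_rotate p.1).measurable.comp
      (AffGr.continuous_emb_subtype p.2.2).measurable) hs]
  rfl

/-- Integration over the `m`-planes `ζ`, with a weight that depends on the distance of `ζ` to the
origin, of the average over the `k`-planes contained in `ζ`. -/
theorem AffGr.lintegral_weight_mul_subMeasure (W : Gr m V) {φ : AffGr k V → ℝ≥0∞}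
    (hφ : Measurable φ) {ω : ℝ → ℝ≥0∞} (hω : Measurable ω) :
    ∫⁻ ζ : AffGr m V, ω ‖ζ.foot‖ * ∫⁻ τ, φ τ ∂AffGr.subMeasure k ζ.dir.sub ζ.foot
        ∂AffGr.measure m V =
      ∫⁻ τ, ω ‖W.subᗮ.starProjection τ.foot‖ * ∫⁻ U, φ (AffGr.rotate U τ) ∂orthHaar V
        ∂AffGr.dirMeasure k W.sub := by
  have hm := (AffGr.continuous_rotate_emb (k := k) W).measurable
  have hmφ : Measurable fun p : (Orth V × W.subᗮ) × AffGr k W.sub => ω ‖(p.1.2 : V)‖ *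
      φ (AffGr.rotate p.1.1 (AffGr.emb W.sub.subtypeₗᵢ (p.1.2 : V) p.2)) :=
    (hω.comp (by fun_prop)).mul (hφ.comp hm)
  have hmζ : Measurable fun ζ : AffGr m V =>
      ω ‖ζ.foot‖ * ∫⁻ τ, φ τ ∂AffGr.subMeasure k ζ.dir.sub ζ.foot :=
    (hω.comp (AffGr.continuous_foot.norm).measurable).mul
      ((Measure.measurable_lintegral hφ).comp AffGr.measurable_subMeasure)
  have hΘ : Measurable fun τ : AffGr k V => ∫⁻ U, φ (AffGr.rotate U τ) ∂orthHaar V :=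
    (hφ.comp AffGr.continuous_rotate_uncurry.measurable).lintegral_prod_left'
  have hΘ' : Measurable fun τ : AffGr k V => ω ‖W.subᗮ.starProjection τ.foot‖ *
      ∫⁻ U, φ (AffGr.rotate U τ) ∂orthHaar V :=
    (hω.comp ((ContinuousLinearMap.continuous _).comp AffGr.continuous_foot).norm.measurable).mul hΘ
  have he := (AffGr.continuous_emb_subtype_uncurry (k := k) W.sub).measurable
  -- Write `ζ = U (W + u)`, so that the weight depends on `u` only, and move the integral over `U`
  -- innermost. The remaining pair of a plane in `W` and a vector `u ∈ Wᗮ` parametrizes the planes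
  -- with direction in `W`, and `u` is the `Wᗮ`-component of the foot.
  rw [AffGr.lintegral_measure_eq W hmζ]
  calc _ = ∫⁻ U, ∫⁻ u : W.subᗮ, ∫⁻ σ, ω ‖(u : V)‖ *
          φ (AffGr.rotate U (AffGr.emb W.sub.subtypeₗᵢ (u : V) σ)) ∂AffGr.measure k W.sub
          ∂eucl W.subᗮ ∂orthHaar V := by
        refine lintegral_congr fun U => ?_
        have hU : Measurable fun τ : AffGr k V => φ (AffGr.rotate U τ) :=
          hφ.comp (AffGr.continuous_rotate U).measurable
        rw [AffGr.lintegral_fibre]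
        refine lintegral_congr fun u => ?_
        rw [AffGr.subMeasure_dir_rotate, AffGr.foot_rotate, AffGr.foot_of _ _ u.2, AffGr.dir_of,
          lintegral_map hφ (AffGr.continuous_rotate U).measurable,
          AffGr.lintegral_subMeasure u.2 hU,
          ContinuousLinearMap.norm_map_of_mem_unitary U.2, lintegral_const_mul]
        exact hU.comp (AffGr.continuous_emb_subtype u.2).measurable
    _ = ∫⁻ p, ∫⁻ σ, ω ‖(p.2 : V)‖ *
          φ (AffGr.rotate p.1 (AffGr.emb W.sub.subtypeₗᵢ (p.2 : V) σ)) ∂AffGr.measure k W.sub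
          ∂((orthHaar V).prod (eucl W.subᗮ)) :=
        (lintegral_prod _ hmφ.lintegral_prod_right'.aemeasurable).symm
    _ = ∫⁻ σ, ∫⁻ p, ω ‖(p.2 : V)‖ *
          φ (AffGr.rotate p.1 (AffGr.emb W.sub.subtypeₗᵢ (p.2 : V) σ))
          ∂((orthHaar V).prod (eucl W.subᗮ)) ∂AffGr.measure k W.sub :=
        lintegral_lintegral_swap hmφ.aemeasurable
    _ = ∫⁻ σ, ∫⁻ u : W.subᗮ, ω ‖(u : V)‖ * ∫⁻ U,
          φ (AffGr.rotate U (AffGr.emb W.sub.subtypeₗᵢ (u : V) σ)) ∂orthHaar V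
          ∂(eucl W.subᗮ) ∂AffGr.measure k W.sub := by
        refine lintegral_congr fun σ => ?_
        have h1 : Measurable fun p : Orth V × W.subᗮ => ω ‖(p.2 : V)‖ *
          φ (AffGr.rotate p.1 (AffGr.emb W.sub.subtypeₗᵢ (p.2 : V) σ)) :=
          hmφ.comp (measurable_id.prodMk measurable_const)
        rw [lintegral_prod_symm _ h1.aemeasurable]
        refine lintegral_congr fun u => ?_
        have h2 : Measurable fun U : Orth V =>
            φ (AffGr.rotate U (AffGr.emb W.sub.subtypeₗᵢ (u : V) σ)) :=
          hφ.comp (AffGr.continuous_rotate_comp continuous_id continuous_const).measurable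
        exact lintegral_const_mul (ω ‖(u : V)‖) h2
    _ = ∫⁻ p, ω ‖(p.2 : V)‖ * ∫⁻ U,
          φ (AffGr.rotate U (AffGr.emb W.sub.subtypeₗᵢ (p.2 : V) p.1)) ∂orthHaar V
          ∂((AffGr.measure k W.sub).prod (eucl W.subᗮ)) := by
        have h2 : Measurable fun p : AffGr k W.sub × W.subᗮ => ‖(p.2 : V)‖ := by fun_prop
        have h3 : Measurable fun p : AffGr k W.sub × W.subᗮ => ω ‖(p.2 : V)‖ * ∫⁻ U,
          φ (AffGr.rotate U (AffGr.emb W.sub.subtypeₗᵢ (p.2 : V) p.1)) ∂orthHaar V :=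
          (hω.comp h2).mul (hΘ.comp he)
        exact (lintegral_prod _ h3.aemeasurable).symm
    _ = _ := by
        rw [AffGr.dirMeasure_eq_map, lintegral_map hΘ' he]
        refine lintegral_congr fun p => ?_
        have h3 : p.2.1 ∈ (LinearMap.range W.sub.subtypeₗᵢ.toLinearMap)ᗮ := by
          rw [range_subtypeₗᵢ]; exact p.2.2
        have h4 : W.subᗮ.starProjection (p.1.foot : V) = 0 :=
          Submodule.starProjection_orthogonal_apply_eq_zero p.1.foot.2
        rw [AffGr.foot_emb _ h3, map_add, Submodule.starProjection_eq_self_iff.mpr p.2.2]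
        simp only [Submodule.coe_subtypeₗᵢ, Submodule.subtype_apply, h4, zero_add]

/-- Averaging over the `k`-planes in `ζ` and then over `ζ` is averaging over all `k`-planes. -/
theorem AffGr.lintegral_subMeasure_measure (W : Gr m V) (ξ₀ : Gr k W.sub) {φ : AffGr k V → ℝ≥0∞}
    (hφ : Measurable φ) :
    ∫⁻ ζ : AffGr m V, ∫⁻ τ, φ τ ∂AffGr.subMeasure k ζ.dir.sub ζ.foot ∂AffGr.measure m V =
      ∫⁻ τ, φ τ ∂AffGr.measure k V := by
  have h := AffGr.lintegral_weight_mul_subMeasure W hφ (ω := fun _ => 1) measurable_const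
  simp only [one_mul] at h
  have hmU : Measurable fun p : Orth V × AffGr k V => φ (AffGr.rotate p.1 p.2) :=
    hφ.comp AffGr.continuous_rotate_uncurry.measurable
  have := Gr.isProbabilityMeasure_of_point ξ₀
  rw [h, AffGr.lintegral_dirMeasure _ hmU.lintegral_prod_left']
  calc _ = ∫⁻ _ : Gr k W.sub, ∫⁻ τ, φ τ ∂AffGr.measure k V ∂Gr.measure k W.sub := by
        refine lintegral_congr fun ξ => ?_
        rw [AffGr.lintegral_measure_eq ξ.incl hφ]
        exact (lintegral_lintegral_swap hmU.aemeasurable).symm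
    _ = _ := by simp

end Averages

/-! ### Slices and Radon transforms as integrals over the affine Grassmannian of a subspace -/

section Slices

/-- Isometries act by homeomorphisms, so integrals of arbitrary functions can be transferred; the
formulas for slices and Radon transforms below need no measurability of `f`. -/
theorem Gr.measurableEmbedding_map (e : V ≃ₗᵢ[ℝ] V') :
    MeasurableEmbedding (Gr.map (k := k) e.toLinearIsometry) := by
  let E : Gr k V ≃ₜ Gr k V' :=
    { toFun := Gr.map e.toLinearIsometry
      invFun := Gr.map e.symm.toLinearIsometry
      left_inv := fun W => by
        rw [Gr.map_map]; convert Gr.map_id W; ext x; simp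
      right_inv := fun W => by
        rw [Gr.map_map]; convert Gr.map_id W; ext x; simp
      continuous_toFun := Gr.continuous_map _
      continuous_invFun := Gr.continuous_map _ }
  exact E.measurableEmbedding

theorem AffGr.emb_id (τ : AffGr k V) : AffGr.emb LinearIsometry.id 0 τ = τ := by
  rw [AffGr.emb, Gr.map_id, add_zero]
  exact AffGr.of_dir_foot τ

theorem AffGr.measurableEmbedding_emb (e : V ≃ₗᵢ[ℝ] V') :
    MeasurableEmbedding (AffGr.emb (k := k) e.toLinearIsometry 0) := by
  let E : AffGr k V ≃ₜ AffGr k V' :=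
    { toFun := AffGr.emb e.toLinearIsometry 0
      invFun := AffGr.emb e.symm.toLinearIsometry 0
      left_inv := fun τ => by
        rw [AffGr.emb_emb, map_zero, add_zero]; convert AffGr.emb_id τ; ext x; simp
      right_inv := fun τ => by
        rw [AffGr.emb_emb, map_zero, add_zero]; convert AffGr.emb_id τ; ext x; simp
      continuous_toFun := AffGr.continuous_emb_zero _
      continuous_invFun := AffGr.continuous_emb_zero _ }
  exact E.measurableEmbedding

variable [MeasurableSpace V] [BorelSpace V]

/-- The orthogonal complement of `ξ` in `h` is `ξᗮ ∩ h`. -/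
def Gr.orthogonalInf {h : Submodule ℝ V} (ξ : Gr k h) :
    ξ.subᗮ ≃ₗᵢ[ℝ] ↥(ξ.incl.subᗮ ⊓ h) :=
  let L : ξ.subᗮ →ₗ[ℝ] ↥(ξ.incl.subᗮ ⊓ h) :=
    { toFun := fun x => ⟨((x : h) : V), Gr.mem_orthogonal_map (L := h.subtypeₗᵢ) x.2, x.1.2⟩
      map_add' := fun _ _ => rfl
      map_smul' := fun _ _ => rfl }
  LinearIsometryEquiv.ofSurjective { toLinearMap := L, norm_map' := fun _ => rfl } (by
    rintro ⟨y, hy, hyh⟩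
    exact ⟨⟨⟨y, hyh⟩, fun w hw => hy _ ⟨w, hw, rfl⟩⟩, rfl⟩)

theorem Gr.measurableEmbedding_orthogonalInf {h : Submodule ℝ V} (ξ : Gr k h) :
    MeasurableEmbedding (Gr.orthogonalInf ξ) :=
  (Gr.orthogonalInf ξ).toHomeomorph.measurableEmbedding

theorem AffGr.emb_of_orthogonalInf {h : Submodule ℝ V} (α : V) (ξ : Gr k h) (u : ξ.subᗮ) :
    AffGr.emb h.subtypeₗᵢ α (AffGr.of ξ (u : h)) =
      AffGr.of ξ.incl ((Gr.orthogonalInf ξ u : V) + α) :=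
  AffGr.emb_of _ _ _ _

/-- The complement `ξᗮ ⊓ h` in `V` is the orthogonal complement of `ξ` within `h`. This and the next
two statements allow all later work to take place in `h` itself. -/
theorem sliceConverges_iff (f : AffGr k V → ℂ) (h : Submodule ℝ V) (α : V) (ξ : Gr k h) :
    SliceConverges f h α ξ ↔
      Integrable (fun τ => f (AffGr.emb h.subtypeₗᵢ α τ)) (AffGr.fibre ξ) := by
  rw [SliceConverges, AffGr.integrable_fibre, ← map_eucl (Gr.orthogonalInf ξ),
    (Gr.measurableEmbedding_orthogonalInf ξ).integrable_map_iff]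
  simp only [AffGr.emb_of_orthogonalInf, Function.comp_def]

theorem sliceInt_eq (f : AffGr k V → ℂ) (h : Submodule ℝ V) (α : V) (ξ : Gr k h) :
    sliceInt f h α ξ = ∫ τ, f (AffGr.emb h.subtypeₗᵢ α τ) ∂AffGr.fibre ξ := by
  rw [sliceInt, AffGr.integral_fibre, ← map_eucl (Gr.orthogonalInf ξ),
    (Gr.measurableEmbedding_orthogonalInf ξ).integral_map]
  simp only [AffGr.emb_of_orthogonalInf]

theorem lintegral_slice_eq (f : AffGr k V → ℂ) (h : Submodule ℝ V) (α : V) (ξ : Gr k h) :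
    ∫⁻ x : ↥(ξ.incl.subᗮ ⊓ h), ‖f (AffGr.of ξ.incl (x + α))‖ₑ ∂(eucl _) =
      ∫⁻ τ, ‖f (AffGr.emb h.subtypeₗᵢ α τ)‖ₑ ∂AffGr.fibre ξ := by
  rw [AffGr.lintegral_fibre, ← map_eucl (Gr.orthogonalInf ξ),
    (Gr.measurableEmbedding_orthogonalInf ξ).lintegral_map]
  simp only [AffGr.emb_of_orthogonalInf]

/-- The iterated integral of `F` over the planes contained in `h + v`. -/
def planeInt (F : AffGr k V → ℂ) (h : Submodule ℝ V) (v : V) : ℂ :=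
  ∫ ξ : Gr k h, ∫ τ, F (AffGr.emb h.subtypeₗᵢ v τ) ∂AffGr.fibre ξ ∂Gr.measure k h

/-- The iterated integral of `|F|` over the planes contained in `h + v`. -/
def planeAbs (F : AffGr k V → ℂ) (h : Submodule ℝ V) (v : V) : ℝ≥0∞ :=
  ∫⁻ ξ : Gr k h, ∫⁻ τ, ‖F (AffGr.emb h.subtypeₗᵢ v τ)‖ₑ ∂AffGr.fibre ξ ∂Gr.measure k h

theorem radonAbs_eq (f : AffGr k V → ℂ) (ζ : AffGr m V) :
    radonAbs f ζ = planeAbs f ζ.dir.sub ζ.foot := by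
  rw [radonAbs, planeAbs]
  refine lintegral_congr fun ξ => ?_
  rw [← lintegral_slice_eq]
  simp only [add_comm]

theorem radon_eq (f : AffGr k V → ℂ) (ζ : AffGr m V) :
    radon f ζ = planeInt f ζ.dir.sub ζ.foot := by
  rw [radon, planeInt]
  refine integral_congr_ae (ae_of_all _ fun ξ => ?_)
  dsimp only
  rw [← sliceInt_eq, sliceInt]
  simp only [add_comm]

variable [MeasurableSpace V'] [BorelSpace V']

/-- With `L` the inclusion of `h`, the Radon transform of `f` at the plane `η + w + α` becomes one
computed inside `h`. -/
theorem planeInt_map (F : AffGr k V' → ℂ) (L : V →ₗᵢ[ℝ] V') (η : Gr m V) (w : V) (α : V') :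
    planeInt F (η.map L).sub (L w + α) = planeInt (fun τ => F (AffGr.emb L α τ)) η.sub w := by
  rw [planeInt, planeInt, ← Gr.map_measure (Gr.subEquiv L η),
    (Gr.measurableEmbedding_map _).integral_map]
  refine integral_congr_ae (ae_of_all _ fun ξ => ?_)
  dsimp only
  rw [← AffGr.map_emb_fibre, (AffGr.measurableEmbedding_emb _).integral_map]
  simp only [AffGr.emb_emb_subEquiv]

theorem planeAbs_map (F : AffGr k V' → ℂ) (L : V →ₗᵢ[ℝ] V') (η : Gr m V) (w : V) (α : V') :
    planeAbs F (η.map L).sub (L w + α) = planeAbs (fun τ => F (AffGr.emb L α τ)) η.sub w := by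
  rw [planeAbs, planeAbs, ← Gr.map_measure (Gr.subEquiv L η),
    (Gr.measurableEmbedding_map _).lintegral_map]
  refine lintegral_congr fun ξ => ?_
  rw [← AffGr.map_emb_fibre, (AffGr.measurableEmbedding_emb _).lintegral_map]
  simp only [AffGr.emb_emb_subEquiv]

end Slices

/-! ### Fubini's theorem on the affine Grassmannian -/

section Fubini

/-- A Bochner integral over a mixture of measures is an iterated integral. -/
theorem integral_bind_of_integrable {X Y : Type*} [MeasurableSpace X] [MeasurableSpace Y]
    {μ : Measure X} {κ : X → Measure Y} (hκ : Measurable κ) {F : Y → ℂ}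
    (hF : Integrable F (μ.bind κ)) :
    (∀ᵐ x ∂μ, Integrable F (κ x)) ∧ Integrable (fun x => ∫ y, F y ∂κ x) μ ∧
      ∫ y, F y ∂(μ.bind κ) = ∫ x, ∫ y, F y ∂κ x ∂μ := by
  let K : Kernel X Y := ⟨κ, hκ⟩
  have hF' : Integrable F ((K ∘ₖ Kernel.const Unit μ) ()) := by
    rw [← Measure.comp_eq_comp_const_apply]; exact hF
  have h1 := hF'.ae_of_comp
  have h2 := hF'.integral_comp
  have h3 := Kernel.integral_comp hF'
  rw [Kernel.const_apply] at h1 h2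
  rw [← Measure.comp_eq_comp_const_apply, Kernel.const_apply] at h3
  exact ⟨h1, h2, h3⟩

variable [CompleteSpace V] [MeasurableSpace V] [BorelSpace V]

theorem planeAbs_lt_top {F : AffGr k V → ℂ} {h : Submodule ℝ V} {v : V}
    (hF : Integrable (fun τ => F (AffGr.emb h.subtypeₗᵢ v τ)) (AffGr.measure k h)) :
    planeAbs F h v < ∞ := by
  have h1 := Measure.lintegral_bind (m := Gr.measure k h)
    AffGr.measurable_fibre.aemeasurable hF.1.enorm
  rw [planeAbs, ← h1]
  exact hF.2

/-- An iterated integral determines the integral over the mixture only for a measurable integrand.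
Borel measurability of `F` survives restriction to every single plane, whereas almost everywhere
measurability need not. -/
theorem integrable_of_planeAbs_lt_top {F : AffGr k V → ℂ} (hF : Measurable F) {h : Submodule ℝ V}
    {v : V} (hv : v ∈ hᗮ) (hfin : planeAbs F h v < ∞) :
    Integrable (fun τ => F (AffGr.emb h.subtypeₗᵢ v τ)) (AffGr.measure k h) := by
  have hm : Measurable fun τ : AffGr k h => F (AffGr.emb h.subtypeₗᵢ v τ) :=
    hF.comp (AffGr.continuous_emb_subtype hv).measurable
  refine ⟨hm.aestronglyMeasurable, ?_⟩
  rw [HasFiniteIntegral, AffGr.lintegral_measure hm.enorm]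
  exact hfin

theorem planeInt_eq {F : AffGr k V → ℂ} {h : Submodule ℝ V} {v : V}
    (hF : Integrable (fun τ => F (AffGr.emb h.subtypeₗᵢ v τ)) (AffGr.measure k h)) :
    planeInt F h v = ∫ τ, F (AffGr.emb h.subtypeₗᵢ v τ) ∂AffGr.measure k h :=
  (integral_bind_of_integrable AffGr.measurable_fibre hF).2.2.symm

/-- Fubini's theorem for the planes whose direction is contained in `h`. -/
theorem fubini_dirMeasure {F : AffGr k V → ℂ} {h : Submodule ℝ V}
    (hF : Integrable F (AffGr.dirMeasure k h)) :
    (∀ᵐ w : hᗮ ∂eucl hᗮ, planeAbs F h (w : V) < ∞) ∧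
      Integrable (fun w : hᗮ => planeInt F h (w : V)) (eucl hᗮ) ∧
      ∫ τ, F τ ∂AffGr.dirMeasure k h = ∫ w : hᗮ, planeInt F h (w : V) ∂eucl hᗮ := by
  have hm : Measurable fun p : AffGr k h × hᗮ => AffGr.emb h.subtypeₗᵢ (p.2 : V) p.1 :=
    (AffGr.continuous_emb_subtype_uncurry h).measurable
  rw [AffGr.dirMeasure_eq_map] at hF ⊢
  have hF' : Integrable (fun p : AffGr k h × hᗮ => F (AffGr.emb h.subtypeₗᵢ (p.2 : V) p.1))
      ((AffGr.measure k h).prod (eucl hᗮ)) := hF.comp_measurable hm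
  have hae : ∀ᵐ w : hᗮ ∂eucl hᗮ, Integrable (fun τ => F (AffGr.emb h.subtypeₗᵢ (w : V) τ))
      (AffGr.measure k h) := hF'.prod_left_ae
  have heq : (fun w : hᗮ => ∫ τ, F (AffGr.emb h.subtypeₗᵢ (w : V) τ) ∂AffGr.measure k h) =ᵐ[eucl hᗮ]
      fun w : hᗮ => planeInt F h (w : V) := hae.mono fun w hw => (planeInt_eq hw).symm
  refine ⟨hae.mono fun w hw => planeAbs_lt_top hw, hF'.integral_prod_right.congr heq, ?_⟩
  rw [integral_map hm.aemeasurable hF.1, integral_prod_symm _ hF', integral_congr_ae heq]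

/-- The integral of `F` over `AffGr.dirMeasure k η.sub` is evaluated twice: `h1`, `h2`, `h3` sort by
direction, and `h4`, `h5`, `h6` by the translate of `η`. What remains is to move both results from
`h` to the ambient space. -/
theorem sliceIdentity_of_integrable {f : AffGr k V → ℂ} {h : Submodule ℝ V} {α : V} (hα : α ∈ hᗮ)
    (η : Gr m h) (hF : Integrable (fun τ => f (AffGr.emb h.subtypeₗᵢ α τ))
      (AffGr.dirMeasure k η.sub)) : SliceIdentity f h α η := by
  have hF' := hF
  rw [AffGr.dirMeasure_eq_bind] at hF'
  obtain ⟨h1, h2, h3⟩ := integral_bind_of_integrable AffGr.measurable_fibre_incl hF'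
  rw [← AffGr.dirMeasure_eq_bind] at h3
  obtain ⟨h4, h5, h6⟩ := fubini_dirMeasure hF
  have hmem : ∀ w : η.subᗮ, ((Gr.orthogonalInf η w : V) + α) ∈ η.incl.subᗮ := fun w =>
    Submodule.add_mem _ (Gr.orthogonalInf η w).2.1
      (Gr.mem_orthogonal_map_of_range (L := h.subtypeₗᵢ) (by rwa [range_subtypeₗᵢ]))
  have hr : ∀ w : η.subᗮ, radon f (AffGr.of η.incl ((Gr.orthogonalInf η w : V) + α)) =
      planeInt (fun τ => f (AffGr.emb h.subtypeₗᵢ α τ)) η.sub w := fun w => by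
    rw [radon_eq, AffGr.dir_of, AffGr.foot_of _ _ (hmem w)]
    exact planeInt_map f h.subtypeₗᵢ η w α
  have hra : ∀ w : η.subᗮ, radonAbs f (AffGr.of η.incl ((Gr.orthogonalInf η w : V) + α)) =
      planeAbs (fun τ => f (AffGr.emb h.subtypeₗᵢ α τ)) η.sub w := fun w => by
    rw [radonAbs_eq, AffGr.dir_of, AffGr.foot_of _ _ (hmem w)]
    exact planeAbs_map f h.subtypeₗᵢ η w α
  have hme := Gr.measurableEmbedding_orthogonalInf η
  refine ⟨?_, ?_, ?_, ?_, ?_⟩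
  · simpa only [sliceConverges_iff] using h1
  · simpa only [sliceInt_eq] using h2
  · rw [← map_eucl (Gr.orthogonalInf η), hme.ae_map_iff]
    simpa only [hra] using h4
  · rw [← map_eucl (Gr.orthogonalInf η), hme.integrable_map_iff]
    simpa only [Function.comp_def, hr] using h5
  · rw [← map_eucl (Gr.orthogonalInf η), hme.integral_map, funk]
    simp only [hr, sliceInt_eq]
    rw [← h6, h3]

theorem slice_of_integrable {f : AffGr k V → ℂ} {h : Submodule ℝ V} {α : V} (hα : α ∈ hᗮ)
    (η₀ : Gr m h) (ξ₀ : Gr k η₀.sub)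
    (hF : Integrable (fun τ => f (AffGr.emb h.subtypeₗᵢ α τ)) (AffGr.measure k h)) :
    (∀ᵐ ξ ∂(Gr.measure k h), SliceConverges f h α ξ) ∧
      Integrable (sliceInt f h α) (Gr.measure k h) ∧
      ∀ᵐ η ∂(Gr.measure m h), SliceIdentity (k := k) f h α η := by
  obtain ⟨h1, h2, -⟩ := integral_bind_of_integrable AffGr.measurable_fibre hF
  rw [← AffGr.bind_dirMeasure η₀ ξ₀] at hF
  have h3 := (integral_bind_of_integrable AffGr.measurable_dirMeasure hF).1
  refine ⟨?_, ?_, h3.mono fun η hη => sliceIdentity_of_integrable hα η hη⟩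
  · simpa only [sliceConverges_iff] using h1
  · have : sliceInt f h α = fun ξ : Gr k h => ∫ τ, f (AffGr.emb h.subtypeₗᵢ α τ) ∂AffGr.fibre ξ :=
      funext fun ξ => sliceInt_eq f h α ξ
    rw [this]
    exact h2

end Fubini

/-! ### Radial integrals -/

section Radial

variable [MeasurableSpace V] [BorelSpace V]

theorem lintegral_eucl_norm {W : Submodule ℝ V} {N : ℕ} (hN : Module.finrank ℝ W = N)
    (ψ : ℝ → ℝ≥0∞) :
    ∫⁻ u : W, ψ ‖(u : V)‖ ∂eucl W = ∫⁻ x : EuclideanSpace ℝ (Fin N), ψ ‖x‖ := by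
  subst hN
  let _ : MeasureSpace W := measureSpaceOfInnerProductSpace
  let e := (stdOrthonormalBasis ℝ W).repr
  have h := e.measurePreserving.lintegral_comp_emb e.toHomeomorph.measurableEmbedding
    (fun x => ψ ‖x‖)
  rw [← h]
  refine lintegral_congr fun u => ?_
  rw [e.norm_map]
  rfl

theorem lintegral_eucl_indicator {W : Submodule ℝ V} {N : ℕ} (hN : Module.finrank ℝ W = N)
    {r : ℝ} (hr : 0 ≤ r) :
    ∫⁻ u : W, (Set.Iic r).indicator 1 ‖(u : V)‖ ∂eucl W =
      ENNReal.ofReal (r ^ N) * volume (Metric.closedBall (0 : EuclideanSpace ℝ (Fin N)) 1) := by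
  rw [lintegral_eucl_norm hN]
  have h1 : ∀ x : EuclideanSpace ℝ (Fin N), (Set.Iic r).indicator (1 : ℝ → ℝ≥0∞) ‖x‖ =
      (Metric.closedBall (0 : EuclideanSpace ℝ (Fin N)) r).indicator 1 x := fun x => by
    simp [Set.indicator]
  simp only [h1]
  rw [lintegral_indicator_one Metric.isClosed_closedBall.measurableSet,
    Measure.addHaar_closedBall' _ _ hr, finrank_euclideanSpace_fin]

end Radial

/-! ### Averaging over the orthogonal transformations that fix a subspace -/

section Fixing

variable [CompleteSpace V]

/-- The orthogonal transformations that fix `ξ` pointwise. -/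
def Gr.fixing (ξ : Gr k V) : Subgroup (Orth V) where
  carrier := {g | ∀ x ∈ ξ.sub, g.1 x = x}
  one_mem' := fun _ _ => rfl
  mul_mem' := fun {a b} ha hb x hx => by
    change a.1 (b.1 x) = x
    rw [hb x hx, ha x hx]
  inv_mem' := fun {a} ha x hx => by
    have h : ((a⁻¹ * a : Orth V)).1 x = x := by rw [inv_mul_cancel]; rfl
    have h2 : (a⁻¹).1 (a.1 x) = x := h
    rwa [ha x hx] at h2

instance compactSpace_fixing (ξ : Gr k V) : CompactSpace ξ.fixing := by
  refine isCompact_iff_compactSpace.mp (IsClosed.isCompact ?_)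
  have h : (ξ.fixing : Set (Orth V)) = ⋂ x ∈ ξ.sub, {g : Orth V | g.1 x = x} := by
    ext g
    simp only [Set.mem_iInter]
    rfl
  rw [h]
  refine isClosed_biInter fun x _ => isClosed_eq ?_ continuous_const
  exact (continuous_subtype_val).clm_apply continuous_const

theorem Gr.rotate_fixing (ξ : Gr k V) (g : ξ.fixing) : Gr.rotate g.1 ξ = ξ := by
  apply Gr.ext
  ext x
  constructor
  · rintro ⟨y, hy, rfl⟩
    have h : g.1.1 y = y := g.2 y hy
    change g.1.1 y ∈ ξ.sub
    rw [h]
    exact hy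
  · intro hx
    exact ⟨x, hx, g.2 x hx⟩

/-- The reflection in the hyperplane orthogonal to `u - v` exchanges `u` and `v`, and it fixes `ξ`
because `u - v` is orthogonal to `ξ`. -/
theorem Gr.exists_fixing {ξ : Gr k V} {u v : V} (hu : u ∈ ξ.subᗮ) (hv : v ∈ ξ.subᗮ)
    (h : ‖u‖ = ‖v‖) : ∃ g : ξ.fixing, g.1.1 u = v := by
  let e : V ≃ₗᵢ[ℝ] V := (Submodule.span ℝ {u - v})ᗮ.reflection
  refine ⟨⟨Unitary.linearIsometryEquiv.symm e, fun x hx => ?_⟩, Submodule.reflection_sub h⟩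
  refine Submodule.reflection_mem_subspace_eq_self (K := (Submodule.span ℝ {u - v})ᗮ) ?_
  rw [Submodule.mem_orthogonal_singleton_iff_inner_left]
  rw [inner_sub_right, hu x hx, hv x hx, sub_zero]

/-- The normalized Haar measure of the group of orthogonal transformations that fix `ξ`. -/
abbrev Gr.fixingHaar (ξ : Gr k V) : Measure ξ.fixing :=
  Measure.haarMeasure (⊤ : TopologicalSpace.PositiveCompacts ξ.fixing)

instance isProbabilityMeasure_fixingHaar (ξ : Gr k V) : IsProbabilityMeasure ξ.fixingHaar :=
  ⟨Measure.haarMeasure_self⟩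

instance isMulRightInvariant_fixingHaar (ξ : Gr k V) : ξ.fixingHaar.IsMulRightInvariant :=
  isMulRightInvariant_haarMeasure_top

/-- The probability that a random rotation of `u` about `ξ` has distance at most `R` to `W`. -/
def Gr.slab (ξ : Gr k V) (W : Submodule ℝ V) (R : ℝ) (u : V) : ℝ≥0∞ :=
  ∫⁻ g : ξ.fixing, (Set.Iic R).indicator 1 ‖Wᗮ.starProjection (g.1.1 u)‖ ∂ξ.fixingHaar

theorem Gr.slab_le_one (ξ : Gr k V) (W : Submodule ℝ V) (R : ℝ) (u : V) : ξ.slab W R u ≤ 1 := by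
  calc ξ.slab W R u ≤ ∫⁻ _ : ξ.fixing, 1 ∂ξ.fixingHaar :=
        lintegral_mono fun g => Set.indicator_le_self' (fun _ _ => zero_le) _
    _ = 1 := by simp

theorem Gr.slab_le_slab_smul (ξ : Gr k V) (W : Submodule ℝ V) (R : ℝ) (u : V) {s : ℝ}
    (hs0 : 0 ≤ s) (hs1 : s ≤ 1) : ξ.slab W R u ≤ ξ.slab W R (s • u) := by
  refine lintegral_mono fun g => ?_
  dsimp only
  by_cases h : ‖Wᗮ.starProjection (g.1.1 u)‖ ≤ R
  · have h2 : ‖Wᗮ.starProjection (g.1.1 (s • u))‖ ≤ R := by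
      rw [map_smul, map_smul, norm_smul, Real.norm_of_nonneg hs0]
      exact (mul_le_of_le_one_left (norm_nonneg _) hs1).trans h
    rw [Set.indicator_of_mem (Set.mem_Iic.mpr h), Set.indicator_of_mem (Set.mem_Iic.mpr h2)]
    exact le_rfl
  · rw [Set.indicator_of_notMem (by simpa using h)]
    exact zero_le

theorem Gr.slab_fixing (ξ : Gr k V) (W : Submodule ℝ V) (R : ℝ) (u : V) (g : ξ.fixing) :
    ξ.slab W R (g.1.1 u) = ξ.slab W R u := by
  rw [Gr.slab, Gr.slab]
  exact lintegral_mul_right_eq_self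
    (fun x : ξ.fixing => (Set.Iic R).indicator 1 ‖Wᗮ.starProjection (x.1.1 u)‖) g

/-- On `ξᗮ` the averaged weight depends on the norm only, since the rotations fixing `ξ` are
transitive on spheres there; shrinking a vector keeps it in the slab. -/
theorem Gr.slab_anti (ξ : Gr k V) (W : Submodule ℝ V) (R : ℝ) {u v : V} (hu : u ∈ ξ.subᗮ)
    (hv : v ∈ ξ.subᗮ) (h : ‖v‖ ≤ ‖u‖) : ξ.slab W R u ≤ ξ.slab W R v := by
  rcases eq_or_ne u 0 with rfl | hu0
  · rw [norm_zero, norm_le_zero_iff] at h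
    rw [h]
  have hu0' : 0 < ‖u‖ := norm_pos_iff.mpr hu0
  have hs0 : 0 ≤ ‖v‖ / ‖u‖ := by positivity
  obtain ⟨g, hg⟩ := Gr.exists_fixing (Submodule.smul_mem _ (‖v‖ / ‖u‖) hu) hv (by
    rw [norm_smul, Real.norm_of_nonneg hs0, div_mul_cancel₀ _ hu0'.ne'])
  rw [← hg, Gr.slab_fixing]
  exact Gr.slab_le_slab_smul ξ W R u hs0 ((div_le_one hu0').mpr h)

variable [MeasurableSpace V] [BorelSpace V]

theorem AffGr.lintegral_fibre_rotate (ξ : Gr k V) (g : ξ.fixing) {Φ : AffGr k V → ℝ≥0∞}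
    (hΦ : Measurable Φ) :
    ∫⁻ τ, Φ (AffGr.rotate g.1 τ) ∂AffGr.fibre ξ = ∫⁻ τ, Φ τ ∂AffGr.fibre ξ := by
  conv_rhs => rw [← Gr.rotate_fixing ξ g, ← AffGr.map_rotate_fibre]
  rw [lintegral_map hΦ (AffGr.continuous_rotate _).measurable]

theorem AffGr.measurable_indicator_foot (W : Submodule ℝ V) (R : ℝ) :
    Measurable fun τ : AffGr k V =>
      (Set.Iic R).indicator (1 : ℝ → ℝ≥0∞) ‖Wᗮ.starProjection τ.foot‖ :=
  (measurable_one.indicator measurableSet_Iic).comp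
    ((Wᗮ.starProjection).continuous.comp AffGr.continuous_foot).norm.measurable

theorem AffGr.measurable_indicator_fixing (ξ : Gr k V) (W : Submodule ℝ V) (R : ℝ) :
    Measurable fun p : ξ.fixing × AffGr k V =>
      (Set.Iic R).indicator (1 : ℝ → ℝ≥0∞) ‖Wᗮ.starProjection (p.1.1.1 p.2.foot)‖ := by
  have h0 : Continuous fun p : ξ.fixing × AffGr k V => p.1.1.1 := by fun_prop
  have h1 : Continuous fun p : ξ.fixing × AffGr k V => p.1.1.1 (p.2.foot) :=
    h0.clm_apply (AffGr.continuous_foot.comp continuous_snd)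
  exact (measurable_one.indicator measurableSet_Iic).comp
    (((Wᗮ.starProjection).continuous.comp h1).norm.measurable)

/-- Both the fibre measure and `Θ` are invariant under the rotations fixing `ξ`, so the sharp cutoff
may be replaced by its average, which decays in `‖u‖`. -/
theorem AffGr.lintegral_slab_mul (ξ : Gr k V) (W : Submodule ℝ V) (R : ℝ) {Θ : AffGr k V → ℝ≥0∞}
    (hΘ : Measurable Θ) (hinv : ∀ (g : Orth V) (τ : AffGr k V), Θ (AffGr.rotate g τ) = Θ τ) :
    ∫⁻ τ, (Set.Iic R).indicator 1 ‖Wᗮ.starProjection τ.foot‖ * Θ τ ∂AffGr.fibre ξ =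
      ∫⁻ τ, ξ.slab W R τ.foot * Θ τ ∂AffGr.fibre ξ := by
  have hm0 := AffGr.measurable_indicator_fixing ξ W R
  have hm : Measurable fun p : ξ.fixing × AffGr k V =>
      (Set.Iic R).indicator (1 : ℝ → ℝ≥0∞) ‖Wᗮ.starProjection (p.1.1.1 p.2.foot)‖ * Θ p.2 :=
    hm0.mul (hΘ.comp measurable_snd)
  have hm1 : Measurable fun τ : AffGr k V =>
      (Set.Iic R).indicator (1 : ℝ → ℝ≥0∞) ‖Wᗮ.starProjection τ.foot‖ * Θ τ :=
    (AffGr.measurable_indicator_foot W R).mul hΘ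
  symm
  calc ∫⁻ τ, ξ.slab W R τ.foot * Θ τ ∂AffGr.fibre ξ
      = ∫⁻ τ, ∫⁻ g : ξ.fixing, (Set.Iic R).indicator 1 ‖Wᗮ.starProjection (g.1.1 τ.foot)‖ * Θ τ
          ∂ξ.fixingHaar ∂AffGr.fibre ξ := by
        refine lintegral_congr fun τ => ?_
        have h1 : Measurable fun g : ξ.fixing =>
            (Set.Iic R).indicator (1 : ℝ → ℝ≥0∞) ‖Wᗮ.starProjection (g.1.1 τ.foot)‖ :=
          Measurable.of_uncurry_right (f := fun (g : ξ.fixing) (τ : AffGr k V) =>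
            (Set.Iic R).indicator (1 : ℝ → ℝ≥0∞) ‖Wᗮ.starProjection (g.1.1 τ.foot)‖) hm0
        rw [lintegral_mul_const _ h1, Gr.slab]
    _ = ∫⁻ g : ξ.fixing, ∫⁻ τ, (Set.Iic R).indicator 1 ‖Wᗮ.starProjection (g.1.1 τ.foot)‖ * Θ τ
          ∂AffGr.fibre ξ ∂ξ.fixingHaar := (lintegral_lintegral_swap hm.aemeasurable).symm
    _ = ∫⁻ _ : ξ.fixing, ∫⁻ τ, (Set.Iic R).indicator 1 ‖Wᗮ.starProjection τ.foot‖ * Θ τ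
          ∂AffGr.fibre ξ ∂ξ.fixingHaar := by
        refine lintegral_congr fun g => ?_
        rw [← AffGr.lintegral_fibre_rotate ξ g hm1]
        simp only [hinv, AffGr.foot_rotate]
    _ = _ := by simp

/-- The part of the slab in a ball of radius `r` lies in the product of a ball of radius `r` in `ξᗮ
∩ W` and a ball of radius `R` in `Wᗮ`. -/
theorem AffGr.lintegral_indicator_fibre_le (W : Gr m V) (ξ : Gr k W.sub) {r R : ℝ} (hr : 0 ≤ r)
    (hR : 0 ≤ R) :
    ∫⁻ τ, (Set.Iic R).indicator 1 ‖W.subᗮ.starProjection τ.foot‖ * (Set.Iic r).indicator 1 ‖τ.foot‖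
        ∂AffGr.fibre ξ.incl ≤
      ENNReal.ofReal (r ^ (m - k)) * volume (Metric.closedBall (0 : EuclideanSpace ℝ (Fin (m - k))) 1) *
      (ENNReal.ofReal (R ^ (Module.finrank ℝ V - m)) *
        volume (Metric.closedBall (0 : EuclideanSpace ℝ (Fin (Module.finrank ℝ V - m))) 1)) := by
  have hd1 : Module.finrank ℝ ξ.subᗮ = m - k := by
    have := Submodule.finrank_add_finrank_orthogonal ξ.sub
    rw [ξ.finrank_eq, W.finrank_eq] at this
    omega
  have hd2 : Module.finrank ℝ W.subᗮ = Module.finrank ℝ V - m := by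
    have := Submodule.finrank_add_finrank_orthogonal W.sub
    rw [W.finrank_eq] at this
    omega
  have hI : ∀ s : ℝ, Measurable ((Set.Iic s).indicator (1 : ℝ → ℝ≥0∞)) := fun s =>
    measurable_one.indicator measurableSet_Iic
  have hm : Measurable fun τ : AffGr k V => (Set.Iic R).indicator (1 : ℝ → ℝ≥0∞)
      ‖W.subᗮ.starProjection τ.foot‖ * (Set.Iic r).indicator (1 : ℝ → ℝ≥0∞) ‖τ.foot‖ :=
    (AffGr.measurable_indicator_foot W.sub R).mul
      ((hI r).comp AffGr.continuous_foot.norm.measurable)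
  rw [AffGr.fibre_incl, lintegral_map hm (AffGr.continuous_emb_subtype_uncurry W.sub).measurable,
    ← lintegral_eucl_indicator hd1 hr, ← lintegral_eucl_indicator hd2 hR]
  have h1 : ∫⁻ σ, (Set.Iic r).indicator (1 : ℝ → ℝ≥0∞) ‖σ.foot‖ ∂AffGr.fibre ξ =
      ∫⁻ u : ξ.subᗮ, (Set.Iic r).indicator 1 ‖(u : W.sub)‖ ∂eucl ξ.subᗮ := by
    rw [AffGr.lintegral_fibre]
    refine lintegral_congr fun u => ?_
    rw [AffGr.foot_of _ _ u.2]
  have hf1 : Measurable fun σ : AffGr k W.sub => (Set.Iic r).indicator (1 : ℝ → ℝ≥0∞) ‖σ.foot‖ :=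
    (hI r).comp AffGr.continuous_foot.norm.measurable
  have hf2 : Measurable fun u : W.subᗮ => (Set.Iic R).indicator (1 : ℝ → ℝ≥0∞) ‖(u : V)‖ :=
    (hI R).comp continuous_subtype_val.norm.measurable
  rw [← h1, ← lintegral_prod_mul hf1.aemeasurable hf2.aemeasurable]
  refine lintegral_mono fun p => ?_
  dsimp only
  have h3 : p.2.1 ∈ (LinearMap.range W.sub.subtypeₗᵢ.toLinearMap)ᗮ := by
    rw [range_subtypeₗᵢ]; exact p.2.2
  have h4 : W.subᗮ.starProjection (p.1.foot : V) = 0 :=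
    Submodule.starProjection_orthogonal_apply_eq_zero p.1.foot.2
  rw [AffGr.foot_emb _ h3, map_add, Submodule.starProjection_eq_self_iff.mpr p.2.2]
  simp only [Submodule.coe_subtypeₗᵢ, Submodule.subtype_apply, h4, zero_add]
  rw [mul_comm]
  gcongr
  have h5 : ‖p.1.foot‖ ≤ ‖(p.1.foot : V) + (p.2 : V)‖ := by
    have h6 : inner ℝ (p.1.foot : V) (p.2 : V) = 0 := p.2.2 _ p.1.foot.2
    have h7 := norm_add_sq_eq_norm_sq_add_norm_sq_real h6
    change ‖(p.1.foot : V)‖ ≤ _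
    nlinarith [norm_nonneg (p.1.foot : V), norm_nonneg ((p.1.foot : V) + (p.2 : V)),
      norm_nonneg (p.2 : V)]
  by_cases h : ‖(p.1.foot : V) + (p.2 : V)‖ ≤ r
  · rw [Set.indicator_of_mem (Set.mem_Iic.mpr h),
      Set.indicator_of_mem (Set.mem_Iic.mpr (h5.trans h))]
    exact le_rfl
  · rw [Set.indicator_of_notMem (by simpa using h)]
    exact zero_le

end Fixing

/-! ### Almost everywhere existence of the Radon transform -/

section Existence

variable [CompleteSpace V] [MeasurableSpace V] [BorelSpace V]

theorem Gr.finrank_orthogonal (ξ : Gr k V) : Module.finrank ℝ ξ.subᗮ = Module.finrank ℝ V - k := by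
  have := Submodule.finrank_add_finrank_orthogonal ξ.sub
  rw [ξ.finrank_eq] at this
  omega

/-- As the averaged weight is radially decreasing, its value at `u` times the volume of the ball of
radius `‖u‖` is at most its integral over that ball. That integral is the volume of the ball cut by
the slab. -/
theorem Gr.slab_mul_le (W : Gr m V) (ξ : Gr k W.sub) {R : ℝ} (hR : 0 ≤ R) {u : V}
    (hu : u ∈ ξ.incl.subᗮ) :
    ξ.incl.slab W.sub R u * (ENNReal.ofReal (‖u‖ ^ (Module.finrank ℝ V - k)) *
        volume (Metric.closedBall (0 : EuclideanSpace ℝ (Fin (Module.finrank ℝ V - k))) 1)) ≤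
      ENNReal.ofReal (‖u‖ ^ (m - k)) *
        volume (Metric.closedBall (0 : EuclideanSpace ℝ (Fin (m - k))) 1) *
      (ENNReal.ofReal (R ^ (Module.finrank ℝ V - m)) *
        volume (Metric.closedBall (0 : EuclideanSpace ℝ (Fin (Module.finrank ℝ V - m))) 1)) := by
  have hI : Measurable ((Set.Iic ‖u‖).indicator (1 : ℝ → ℝ≥0∞)) :=
    measurable_one.indicator measurableSet_Iic
  have hm : Measurable fun τ : AffGr k V => (Set.Iic ‖u‖).indicator (1 : ℝ → ℝ≥0∞) ‖τ.foot‖ :=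
    hI.comp AffGr.continuous_foot.norm.measurable
  have hI' : Measurable fun v : ξ.incl.subᗮ => (Set.Iic ‖u‖).indicator (1 : ℝ → ℝ≥0∞) ‖(v : V)‖ :=
    hI.comp continuous_subtype_val.norm.measurable
  rw [← lintegral_eucl_indicator ξ.incl.finrank_orthogonal (norm_nonneg u)]
  refine le_trans ?_ (AffGr.lintegral_indicator_fibre_le W ξ (norm_nonneg u) hR)
  rw [AffGr.lintegral_slab_mul ξ.incl W.sub R hm, AffGr.lintegral_fibre,
    ← lintegral_const_mul _ hI']
  · refine lintegral_mono fun v => ?_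
    dsimp only
    rw [AffGr.foot_of _ _ v.2]
    by_cases h : ‖(v : V)‖ ≤ ‖u‖
    · exact mul_le_mul_left (Gr.slab_anti ξ.incl W.sub R hu v.2 h) _
    · rw [Set.indicator_of_notMem (by simpa using h), mul_zero]
      exact zero_le
  · intro g τ
    rw [AffGr.foot_rotate, ContinuousLinearMap.norm_map_of_mem_unitary g.2]

theorem toReal_volume_closedBall_pos (N : ℕ) :
    0 < (volume (Metric.closedBall (0 : EuclideanSpace ℝ (Fin N)) 1)).toReal :=
  ENNReal.toReal_pos (Metric.measure_closedBall_pos _ _ one_pos).ne' measure_closedBall_lt_top.ne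

theorem Gr.exists_slab_le (W : Gr m V) (hkm : k ≤ m) {R : ℝ} (hR : 0 ≤ R) :
    ∃ B : ℝ, 0 ≤ B ∧ ∀ (ξ : Gr k W.sub) (u : V), u ∈ ξ.incl.subᗮ → ξ.incl.slab W.sub R u ≤
      ENNReal.ofReal (B * ((1 + ‖u‖) ^ (Module.finrank ℝ V - m))⁻¹) := by
  have hmn : m ≤ Module.finrank ℝ V := W.finrank_eq ▸ Submodule.finrank_le W.sub
  set d := Module.finrank ℝ V - m with hd
  have hN : Module.finrank ℝ V - k = (m - k) + d := by omega
  let c : ℕ → ℝ := fun N => (volume (Metric.closedBall (0 : EuclideanSpace ℝ (Fin N)) 1)).toReal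
  have hc : ∀ N, 0 < c N := toReal_volume_closedBall_pos
  have hcv : ∀ N, volume (Metric.closedBall (0 : EuclideanSpace ℝ (Fin N)) 1) =
      ENNReal.ofReal (c N) := fun N => (ENNReal.ofReal_toReal measure_closedBall_lt_top.ne).symm
  have hA : 0 ≤ c (m - k) * (R ^ d * c d) / c (m - k + d) := by
    have := hc (m - k); have := hc d; have := hc (m - k + d); positivity
  set A : ℝ := c (m - k) * (R ^ d * c d) / c (m - k + d) with hAdef
  -- `A` is the constant in the volume bound `A ‖u‖^{-d}`, used for `‖u‖ > 1`; the `1` covers the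
  -- trivial bound for `‖u‖ ≤ 1`. The factor `2 ^ d` pays for `1 + ‖u‖`, which is at most `2` or `2
  -- ‖u‖` respectively.
  refine ⟨2 ^ d * (1 + A), by positivity, fun ξ u hu => ?_⟩
  rcases le_or_gt ‖u‖ 1 with h1 | h1
  · refine (Gr.slab_le_one _ _ _ _).trans ?_
    rw [← ENNReal.ofReal_one]
    refine ENNReal.ofReal_le_ofReal ?_
    rw [← div_eq_mul_inv, le_div_iff₀ (by positivity), one_mul]
    calc (1 + ‖u‖) ^ d ≤ 2 ^ d := by gcongr; linarith
      _ ≤ 2 ^ d * (1 + A) := le_mul_of_one_le_right (by positivity) (by linarith)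
  · have hr0 : 0 < ‖u‖ := by linarith
    have h2 := Gr.slab_mul_le W ξ hR hu
    rw [hN, ← hd, hcv, hcv, hcv, ← ENNReal.ofReal_mul (by positivity),
      ← ENNReal.ofReal_mul (by positivity), ← ENNReal.ofReal_mul (by positivity),
      ← ENNReal.ofReal_mul (mul_nonneg (by positivity) (hc _).le)] at h2
    have hpos : 0 < ‖u‖ ^ (m - k + d) * c (m - k + d) := mul_pos (by positivity) (hc _)
    rw [← ENNReal.le_div_iff_mul_le (Or.inl (ENNReal.ofReal_pos.mpr hpos).ne') (Or.inl ENNReal.ofReal_ne_top),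
      ← ENNReal.ofReal_div_of_pos hpos] at h2
    refine h2.trans (ENNReal.ofReal_le_ofReal ?_)
    have h3 : ‖u‖ ^ (m - k) * c (m - k) * (R ^ d * c d) / (‖u‖ ^ (m - k + d) * c (m - k + d)) =
        A * (‖u‖ ^ d)⁻¹ := by
      rw [hAdef, pow_add]
      have := (hc (m - k + d)).ne'
      field_simp
    rw [h3]
    have h4 : (‖u‖ ^ d)⁻¹ ≤ 2 ^ d * ((1 + ‖u‖) ^ d)⁻¹ := by
      rw [inv_le_iff_one_le_mul₀ (by positivity), mul_right_comm, ← div_eq_mul_inv,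
        le_div_iff₀ (by positivity), one_mul, ← mul_pow]
      gcongr
      linarith
    calc A * (‖u‖ ^ d)⁻¹ ≤ A * (2 ^ d * ((1 + ‖u‖) ^ d)⁻¹) := by gcongr
      _ ≤ (1 + A) * (2 ^ d * ((1 + ‖u‖) ^ d)⁻¹) := by gcongr; linarith
      _ = _ := by ring

theorem lintegral_one_add_norm_rpow_lt_top {N : ℕ} {s : ℝ} (hs : (N : ℝ) < s) (C : ℝ) :
    ∫⁻ x : EuclideanSpace ℝ (Fin N), ENNReal.ofReal (C * (1 + ‖x‖) ^ (-s)) < ∞ := by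
  have h : Integrable fun x : EuclideanSpace ℝ (Fin N) => C * (1 + ‖x‖) ^ (-s) :=
    (integrable_one_add_norm (by simpa using hs)).const_mul C
  refine (lintegral_mono fun x => ?_).trans_lt h.2
  rw [← ofReal_norm]
  exact ENNReal.ofReal_le_ofReal (Real.le_norm_self _)

/-- The averaged weight has an integrable majorant in the dual exponent. -/
theorem Gr.exists_young_majorant (W : Gr m V) (hkm : k ≤ m) {R : ℝ} (hR : 0 ≤ R) {p : ℝ}
    (hp1 : 1 ≤ p) (hp : p * ((m : ℝ) - k) < (Module.finrank ℝ V : ℝ) - k) :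
    ∃ b : ℝ → ℝ≥0∞, Measurable b ∧
      ∫⁻ x : EuclideanSpace ℝ (Fin (Module.finrank ℝ V - k)), b ‖x‖ < ∞ ∧
      ∀ (ξ : Gr k W.sub) (u : V), u ∈ ξ.incl.subᗮ → ∀ a : ℝ≥0∞,
        ξ.incl.slab W.sub R u * a ≤ a ^ p + b ‖u‖ := by
  have hmn : m ≤ Module.finrank ℝ V := W.finrank_eq ▸ Submodule.finrank_le W.sub
  rcases hp1.eq_or_lt with rfl | hp1
  -- For `p = 1` the conjugate exponent is infinite, and the bound of the weight by `1` is enough.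
  · refine ⟨0, measurable_zero, by simp, fun ξ u _ a => ?_⟩
    simpa using mul_le_mul_left (Gr.slab_le_one ξ.incl W.sub R u) a
  obtain ⟨B, hB, hslab⟩ := Gr.exists_slab_le (k := k) W hkm hR
  set d := Module.finrank ℝ V - m with hd
  have hpq : p.HolderConjugate (p / (p - 1)) := Real.HolderConjugate.conjExponent hp1
  set q := p / (p - 1) with hq
  -- The bound on `p` enters here: with `n = finrank V`, clearing the denominator of `(n - m) q > n
  -- - k` gives `p (m - k) < n - k`.
  have hdq : ((Module.finrank ℝ V - k : ℕ) : ℝ) < (d : ℝ) * q := by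
    rw [hq, hd, Nat.cast_sub (hkm.trans hmn), Nat.cast_sub hmn, mul_div_assoc', lt_div_iff₀ (by linarith)]
    nlinarith
  refine ⟨fun r => ENNReal.ofReal (B ^ q * (1 + r) ^ (-((d : ℝ) * q))), by fun_prop,
    lintegral_one_add_norm_rpow_lt_top hdq _, fun ξ u hu a => ?_⟩
  have h1 := ENNReal.young_inequality a (ENNReal.ofReal (B * ((1 + ‖u‖) ^ d)⁻¹)) hpq
  have hq1 : 1 ≤ q := hpq.symm.lt.le
  calc ξ.incl.slab W.sub R u * a ≤ ENNReal.ofReal (B * ((1 + ‖u‖) ^ d)⁻¹) * a :=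
        mul_le_mul_left (hslab ξ u hu) a
    _ = a * ENNReal.ofReal (B * ((1 + ‖u‖) ^ d)⁻¹) := mul_comm _ _
    _ ≤ _ := h1
    -- The factors `1/p` and `1/q` of Young's inequality are at most `1` and are dropped.
    _ ≤ a ^ p + ENNReal.ofReal (B * ((1 + ‖u‖) ^ d)⁻¹) ^ q := by
        gcongr
        · exact ENNReal.div_le_of_le_mul (le_mul_of_one_le_right zero_le
            (ENNReal.one_le_ofReal.mpr hp1.le))
        · exact ENNReal.div_le_of_le_mul (le_mul_of_one_le_right zero_le
            (ENNReal.one_le_ofReal.mpr hq1))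
    _ = _ := by
        rw [ENNReal.ofReal_rpow_of_nonneg (by positivity) (by linarith),
          Real.mul_rpow hB (by positivity), ← Real.rpow_natCast, ← Real.rpow_neg (by positivity),
          ← Real.rpow_mul (by positivity), neg_mul]

theorem AffGr.lintegral_ball_subMeasure_lt_top (W : Gr m V) (hkm : k ≤ m) {R : ℝ} (hR : 0 ≤ R)
    {p : ℝ} (hp1 : 1 ≤ p) (hp : p * ((m : ℝ) - k) < (Module.finrank ℝ V : ℝ) - k)
    {φ : AffGr k V → ℝ≥0∞} (hφ : Measurable φ) (hfin : ∫⁻ τ, φ τ ^ p ∂AffGr.measure k V < ∞) :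
    ∫⁻ ζ : AffGr m V, (Set.Iic R).indicator 1 ‖ζ.foot‖ *
      ∫⁻ τ, φ τ ∂AffGr.subMeasure k ζ.dir.sub ζ.foot ∂AffGr.measure m V < ∞ := by
  have hrot : Measurable fun x : Orth V × AffGr k V => φ (AffGr.rotate x.1 x.2) :=
    hφ.comp AffGr.continuous_rotate_uncurry.measurable
  have hrotp : Measurable fun x : Orth V × AffGr k V => φ (AffGr.rotate x.1 x.2) ^ p :=
    hrot.pow_const p
  have hΘ : Measurable fun τ : AffGr k V => ∫⁻ U, φ (AffGr.rotate U τ) ∂orthHaar V :=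
    hrot.lintegral_prod_left'
  have hinv : ∀ (g : Orth V) (τ : AffGr k V),
      ∫⁻ U, φ (AffGr.rotate U (AffGr.rotate g τ)) ∂orthHaar V =
        ∫⁻ U, φ (AffGr.rotate U τ) ∂orthHaar V := fun g τ => by
    simp only [← AffGr.rotate_mul]
    exact lintegral_mul_right_eq_self (fun U : Orth V => φ (AffGr.rotate U τ)) g
  obtain ⟨b, hb, hbfin, hyoung⟩ := Gr.exists_young_majorant (k := k) W hkm hR hp1 hp
  have hbτ : Measurable fun τ : AffGr k V => b ‖τ.foot‖ :=
    hb.comp AffGr.continuous_foot.norm.measurable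
  have hmain : Measurable fun τ : AffGr k V =>
      (Set.Iic R).indicator (1 : ℝ → ℝ≥0∞) ‖W.subᗮ.starProjection τ.foot‖ *
        ∫⁻ U, φ (AffGr.rotate U τ) ∂orthHaar V :=
    (AffGr.measurable_indicator_foot W.sub R).mul hΘ
  rw [AffGr.lintegral_weight_mul_subMeasure W hφ (measurable_one.indicator measurableSet_Iic),
    AffGr.lintegral_dirMeasure _ hmain]
  -- For each direction, Young's inequality inside the average over `U` splits off the `L^p`
  -- integral of `φ` over all planes and a radial integral on `ξᗮ`. The bound does not depend on
  -- `ξ`, and the directions carry finite mass.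
  have hbound : ∀ ξ : Gr k W.sub,
      ∫⁻ τ, (Set.Iic R).indicator 1 ‖W.subᗮ.starProjection τ.foot‖ *
        ∫⁻ U, φ (AffGr.rotate U τ) ∂orthHaar V ∂AffGr.fibre ξ.incl ≤
      ∫⁻ τ, φ τ ^ p ∂AffGr.measure k V +
        ∫⁻ x : EuclideanSpace ℝ (Fin (Module.finrank ℝ V - k)), b ‖x‖ := fun ξ => by
    rw [AffGr.lintegral_slab_mul ξ.incl W.sub R hΘ hinv]
    calc ∫⁻ τ, ξ.incl.slab W.sub R τ.foot * ∫⁻ U, φ (AffGr.rotate U τ) ∂orthHaar V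
          ∂AffGr.fibre ξ.incl
        ≤ ∫⁻ τ, (∫⁻ U, φ (AffGr.rotate U τ) ^ p ∂orthHaar V + b ‖τ.foot‖)
          ∂AffGr.fibre ξ.incl := by
          rw [AffGr.lintegral_fibre, AffGr.lintegral_fibre]
          refine lintegral_mono fun u => ?_
          dsimp only
          have hU : Measurable fun U : Orth V => φ (AffGr.rotate U (AffGr.of ξ.incl (u : V))) :=
            hφ.comp (AffGr.continuous_rotate_comp continuous_id continuous_const).measurable
          rw [AffGr.foot_of _ _ u.2, ← lintegral_const_mul _ hU]
          calc _ ≤ ∫⁻ U, (φ (AffGr.rotate U (AffGr.of ξ.incl (u : V))) ^ p + b ‖(u : V)‖)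
                ∂orthHaar V := lintegral_mono fun U => hyoung ξ u u.2 _
            _ = _ := by rw [lintegral_add_right _ measurable_const]; simp
      _ = _ := by
          rw [lintegral_add_right _ hbτ, AffGr.lintegral_measure_eq ξ.incl (hφ.pow_const p)]
          congr 1
          · exact (lintegral_lintegral_swap hrotp.aemeasurable).symm
          · rw [AffGr.lintegral_fibre, ← lintegral_eucl_norm ξ.incl.finrank_orthogonal]
            refine lintegral_congr fun u => ?_
            rw [AffGr.foot_of _ _ u.2]
  refine (lintegral_mono hbound).trans_lt ?_
  rw [lintegral_const]
  exact ENNReal.mul_lt_top (ENNReal.add_lt_top.mpr ⟨hfin, hbfin⟩) (measure_lt_top _ _)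

theorem AffGr.bind_subMeasure (W : Gr m V) (ξ₀ : Gr k W.sub) :
    (AffGr.measure m V).bind (fun ζ => AffGr.subMeasure k ζ.dir.sub ζ.foot) =
      AffGr.measure k V := by
  refine Measure.ext_of_lintegral _ fun φ hφ => ?_
  rw [Measure.lintegral_bind AffGr.measurable_subMeasure.aemeasurable hφ.aemeasurable,
    AffGr.lintegral_subMeasure_measure W ξ₀ hφ]

/-- `f` is replaced by a Borel representative `f'`. The measure on `k`-planes is a mixture of the
`subMeasure`s, so the exceptional null set is null within almost every `ζ`. Countably many balls
`‖ζ.foot‖ ≤ j` exhaust all planes. -/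
theorem AffGr.ae_integrable_of_memLp (W : Gr m V) (ξ₀ : Gr k W.sub) {p : ℝ} (hp1 : 1 ≤ p)
    (hp : p * ((m : ℝ) - k) < (Module.finrank ℝ V : ℝ) - k) {f : AffGr k V → ℂ}
    (hf : MemLp f (ENNReal.ofReal p) (AffGr.measure k V)) :
    ∀ᵐ ζ ∂AffGr.measure m V, Integrable
      (fun τ => f (AffGr.emb ζ.dir.sub.subtypeₗᵢ ζ.foot τ)) (AffGr.measure k ζ.dir.sub) := by
  have hkm : k ≤ m := by
    have := Submodule.finrank_le ξ₀.sub
    rwa [ξ₀.finrank_eq, W.finrank_eq] at this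
  have hp0 : 0 < p := by linarith
  let f' := hf.1.mk f
  have hf'm : Measurable f' := hf.1.stronglyMeasurable_mk.measurable
  have hff' : f =ᵐ[AffGr.measure k V] f' := hf.1.ae_eq_mk
  have hfin : ∫⁻ τ, ‖f' τ‖ₑ ^ p ∂AffGr.measure k V < ∞ := by
    have h1 := lintegral_rpow_enorm_lt_top_of_eLpNorm_lt_top (p := ENNReal.ofReal p)
      (by simpa using hp0) ENNReal.ofReal_ne_top ((memLp_congr_ae hff').mp hf).2
    rwa [ENNReal.toReal_ofReal hp0.le] at h1
  have hsub : ∀ᵐ ζ ∂AffGr.measure m V,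
      ∀ᵐ τ ∂AffGr.subMeasure k ζ.dir.sub ζ.foot, f τ = f' τ := by
    let K : Kernel (AffGr m V) (AffGr k V) := ⟨_, AffGr.measurable_subMeasure⟩
    refine Measure.ae_ae_of_ae_comp (κ := K) ?_
    have h1 : K ∘ₘ AffGr.measure m V = AffGr.measure k V := AffGr.bind_subMeasure W ξ₀
    rw [h1]
    exact hff'
  have hballs : ∀ᵐ ζ ∂AffGr.measure m V, ∀ j : ℕ, (Set.Iic (j : ℝ)).indicator 1 ‖ζ.foot‖ *
      ∫⁻ τ, ‖f' τ‖ₑ ∂AffGr.subMeasure k ζ.dir.sub ζ.foot < ∞ := by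
    rw [ae_all_iff]
    intro j
    refine ae_lt_top ?_ (AffGr.lintegral_ball_subMeasure_lt_top W hkm (Nat.cast_nonneg j) hp1 hp
      hf'm.enorm hfin).ne
    exact ((measurable_one.indicator measurableSet_Iic).comp
      AffGr.continuous_foot.norm.measurable).mul
      ((Measure.measurable_lintegral hf'm.enorm).comp AffGr.measurable_subMeasure)
  filter_upwards [hsub, hballs] with ζ h1 h2
  obtain ⟨j, hj⟩ := exists_nat_ge ‖ζ.foot‖
  have h3 := h2 j
  rw [Set.indicator_of_mem (Set.mem_Iic.mpr hj), Pi.one_apply, one_mul] at h3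
  have h4 : Integrable f' (AffGr.subMeasure k ζ.dir.sub ζ.foot) := ⟨hf'm.aestronglyMeasurable, h3⟩
  have h5 : Integrable f (AffGr.subMeasure k ζ.dir.sub ζ.foot) :=
    h4.congr (h1.mono fun _ h => h.symm)
  exact h5.comp_measurable (AffGr.continuous_emb_subtype ζ.foot_mem).measurable

end Existence

/-! ### Continuous functions with decay at infinity -/

section Decay

theorem Gr.nonempty_of_le (h : k ≤ Module.finrank ℝ V) : Nonempty (Gr k V) := by
  obtain ⟨f, hf⟩ := exists_linearIndependent_of_le_finrank (R := ℝ) (M := V) h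
  exact ⟨⟨Submodule.span ℝ (Set.range f), by simpa using finrank_span_eq_card hf⟩⟩

variable [CompleteSpace V]

/-- The planes at distance at most `A` from the origin are the image of the compact set of pairs
`(U, u)` with `‖u‖ ≤ A`. -/
theorem AffGr.exists_bound_of_continuous {f : AffGr k V → ℂ} (hf : Continuous f) (A : ℝ) :
    ∃ M : ℝ, ∀ τ : AffGr k V, ‖τ.foot‖ ≤ A → ‖f τ‖ ≤ M := by
  rcases isEmpty_or_nonempty (Gr k V) with h | ⟨⟨W⟩⟩
  · exact ⟨0, fun τ => h.elim τ.dir⟩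
  have hc : Continuous fun p : Orth V × W.subᗮ =>
      f (AffGr.rotate p.1 (AffGr.of W (p.2 : V))) :=
    hf.comp (AffGr.continuous_rotate_comp continuous_fst ((AffGr.continuous_of continuous_const
      continuous_subtype_val fun x => x.2).comp continuous_snd))
  have hK : IsCompact ((Set.univ : Set (Orth V)) ×ˢ Metric.closedBall (0 : W.subᗮ) A) :=
    isCompact_univ.prod (isCompact_closedBall _ _)
  obtain ⟨M, hM⟩ := hK.exists_bound_of_continuousOn hc.continuousOn
  refine ⟨M, fun τ hτ => ?_⟩
  obtain ⟨U, u, rfl⟩ := AffGr.exists_rotate W τ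
  rw [AffGr.foot_rotate, ContinuousLinearMap.norm_map_of_mem_unitary U.2,
    AffGr.foot_of _ _ u.2] at hτ
  exact hM (U, u) ⟨Set.mem_univ _, mem_closedBall_zero_iff.mpr hτ⟩

theorem MemC.exists_bound {μ : ℝ} (hμ : 0 < μ) {f : AffGr k V → ℂ} (hf : MemC μ f) :
    ∃ C : ℝ, ∀ τ : AffGr k V, ‖f τ‖ ≤ C * (1 + ‖τ.foot‖) ^ (-μ) := by
  obtain ⟨c, hc⟩ := hf.2.bound
  rw [eventually_comap] at hc
  obtain ⟨A₀, hA₀⟩ := eventually_atTop.mp hc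
  -- Taking `A ≥ 1` ensures `1 + r ≤ 2r` beyond `A`, at the cost of a factor `2 ^ μ`.
  set A := max A₀ 1 with hA
  have hA1 : 1 ≤ A := le_max_right _ _
  obtain ⟨M, hM⟩ := AffGr.exists_bound_of_continuous hf.1 A
  refine ⟨max (|M| * (1 + A) ^ μ) (|c| * 2 ^ μ), fun τ => ?_⟩
  have hr : 0 ≤ ‖τ.foot‖ := norm_nonneg _
  have hpos : 0 ≤ (1 + ‖τ.foot‖) ^ (-μ) := by positivity
  rcases le_total ‖τ.foot‖ A with h | h
  · calc ‖f τ‖ ≤ |M| := (hM τ h).trans (le_abs_self _)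
      _ = |M| * (1 + ‖τ.foot‖) ^ μ * (1 + ‖τ.foot‖) ^ (-μ) := by
        rw [mul_assoc, ← Real.rpow_add (by positivity), add_neg_cancel, Real.rpow_zero, mul_one]
      _ ≤ |M| * (1 + A) ^ μ * (1 + ‖τ.foot‖) ^ (-μ) := by gcongr
      _ ≤ _ := by gcongr; exact le_max_left _ _
  · have h0 : 0 < ‖τ.foot‖ := by linarith
    have h1 := hA₀ ‖τ.foot‖ ((le_max_left _ _).trans h) τ τ.dist0_eq
    rw [τ.dist0_eq, Real.norm_of_nonneg (by positivity)] at h1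
    have h2 : ‖τ.foot‖ ^ (-μ) ≤ 2 ^ μ * (1 + ‖τ.foot‖) ^ (-μ) := by
      have h3 : (2 * ‖τ.foot‖) ^ (-μ) ≤ (1 + ‖τ.foot‖) ^ (-μ) :=
        Real.rpow_le_rpow_of_nonpos (by positivity) (by linarith) (by linarith)
      calc ‖τ.foot‖ ^ (-μ) = 2 ^ μ * (2 * ‖τ.foot‖) ^ (-μ) := by
            rw [Real.mul_rpow (by norm_num) hr, ← mul_assoc, ← Real.rpow_add (by norm_num),
              add_neg_cancel, Real.rpow_zero, one_mul]
        _ ≤ _ := by gcongr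
    calc ‖f τ‖ ≤ c * ‖τ.foot‖ ^ (-μ) := h1
      _ ≤ |c| * ‖τ.foot‖ ^ (-μ) := by gcongr; exact le_abs_self c
      _ ≤ |c| * (2 ^ μ * (1 + ‖τ.foot‖) ^ (-μ)) := by gcongr
      _ = |c| * 2 ^ μ * (1 + ‖τ.foot‖) ^ (-μ) := by ring
      _ ≤ _ := by gcongr; exact le_max_right _ _

/-- Adding `α`, orthogonal to `h`, can only lengthen the foot, so the restriction to `h + α`
inherits the decay with a constant independent of `α`. -/
theorem norm_emb_subtype_le {μ C : ℝ} (hμ : 0 < μ) {f : AffGr k V → ℂ}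
    (hf : ∀ τ, ‖f τ‖ ≤ C * (1 + ‖τ.foot‖) ^ (-μ)) {h : Submodule ℝ V} {α : V} (hα : α ∈ hᗮ)
    (τ : AffGr k h) :
    ‖f (AffGr.emb h.subtypeₗᵢ α τ)‖ ≤ |C| * (1 + ‖τ.foot‖) ^ (-μ) := by
  have h1 : ‖(τ.foot : V)‖ ≤ ‖(τ.foot : V) + α‖ := by
    have h6 : inner ℝ (τ.foot : V) α = 0 := hα _ τ.foot.2
    have h7 := norm_add_sq_eq_norm_sq_add_norm_sq_real h6
    nlinarith [norm_nonneg (τ.foot : V), norm_nonneg ((τ.foot : V) + α), norm_nonneg α]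
  have h2 := hf (AffGr.emb h.subtypeₗᵢ α τ)
  rw [AffGr.foot_emb _ (by rwa [range_subtypeₗᵢ])] at h2
  have h3 : (1 + ‖(τ.foot : V) + α‖) ^ (-μ) ≤ (1 + ‖τ.foot‖) ^ (-μ) :=
    Real.rpow_le_rpow_of_nonpos (by positivity) (by simpa using h1) (by linarith)
  calc _ ≤ C * (1 + ‖(τ.foot : V) + α‖) ^ (-μ) := h2
    _ ≤ |C| * (1 + ‖(τ.foot : V) + α‖) ^ (-μ) := by gcongr; exact le_abs_self C
    _ ≤ _ := by gcongr

variable [MeasurableSpace V] [BorelSpace V]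

/-- The threshold for `μ` is the dimension of `ξᗮ`; the bound is uniform in `ξ` because the majorant
is radial. -/
theorem exists_lintegral_fibre_le {μ C : ℝ} (hμ : ((Module.finrank ℝ V - k : ℕ) : ℝ) < μ)
    {F : AffGr k V → ℂ} (hF : ∀ τ, ‖F τ‖ ≤ C * (1 + ‖τ.foot‖) ^ (-μ)) :
    ∃ I : ℝ≥0∞, I < ∞ ∧ ∀ ξ : Gr k V, ∫⁻ τ, ‖F τ‖ₑ ∂AffGr.fibre ξ ≤ I := by
  refine ⟨_, lintegral_one_add_norm_rpow_lt_top hμ C, fun ξ => ?_⟩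
  rw [AffGr.lintegral_fibre, ← lintegral_eucl_norm ξ.finrank_orthogonal
    (fun r => ENNReal.ofReal (C * (1 + r) ^ (-μ)))]
  refine lintegral_mono fun u => ?_
  dsimp only
  rw [← ofReal_norm]
  refine ENNReal.ofReal_le_ofReal ((hF _).trans_eq ?_)
  rw [AffGr.foot_of _ _ u.2]

theorem integrable_fibre_of_decay {μ C : ℝ} (hμ : ((Module.finrank ℝ V - k : ℕ) : ℝ) < μ)
    {F : AffGr k V → ℂ} (hFc : Continuous F)
    (hF : ∀ τ, ‖F τ‖ ≤ C * (1 + ‖τ.foot‖) ^ (-μ)) (ξ : Gr k V) :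
    Integrable F (AffGr.fibre ξ) := by
  obtain ⟨I, hI, hle⟩ := exists_lintegral_fibre_le hμ hF
  exact ⟨hFc.measurable.aestronglyMeasurable, (hle ξ).trans_lt hI⟩

theorem integrable_dirMeasure_of_decay {μ C : ℝ} (hμ : ((Module.finrank ℝ V - k : ℕ) : ℝ) < μ)
    {F : AffGr k V → ℂ} (hFc : Continuous F)
    (hF : ∀ τ, ‖F τ‖ ≤ C * (1 + ‖τ.foot‖) ^ (-μ)) (h : Submodule ℝ V) :
    Integrable F (AffGr.dirMeasure k h) := by
  obtain ⟨I, hI, hle⟩ := exists_lintegral_fibre_le hμ hF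
  refine ⟨hFc.measurable.aestronglyMeasurable, ?_⟩
  rw [HasFiniteIntegral, AffGr.lintegral_dirMeasure h hFc.measurable.enorm]
  refine (lintegral_mono fun ξ => hle _).trans_lt ?_
  rw [lintegral_const]
  exact ENNReal.mul_lt_top hI (measure_lt_top _ _)

theorem integrable_measure_of_decay {μ C : ℝ} (hμ : ((Module.finrank ℝ V - k : ℕ) : ℝ) < μ)
    {F : AffGr k V → ℂ} (hFc : Continuous F)
    (hF : ∀ τ, ‖F τ‖ ≤ C * (1 + ‖τ.foot‖) ^ (-μ)) : Integrable F (AffGr.measure k V) := by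
  obtain ⟨I, hI, hle⟩ := exists_lintegral_fibre_le hμ hF
  refine ⟨hFc.measurable.aestronglyMeasurable, ?_⟩
  rw [HasFiniteIntegral, AffGr.lintegral_measure hFc.measurable.enorm]
  refine (lintegral_mono fun ξ => hle _).trans_lt ?_
  rw [lintegral_const]
  exact ENNReal.mul_lt_top hI (measure_lt_top _ _)

theorem Gr.isQuotientMap_rotate (W : Gr k V) : IsQuotientMap fun U : Orth V => Gr.rotate U W :=
  (Gr.continuous_rotate W).isClosedMap.isQuotientMap (Gr.continuous_rotate W)
    fun W' => Gr.exists_rotate W W'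

/-- The orbit map is a quotient map, being a continuous surjection from a compact to a Hausdorff
space, so continuity is tested on the orthogonal group. There dominated convergence applies:
rotations preserve `‖foot‖`, so the majorant does not depend on `U`. -/
theorem continuous_integral_fibre_of_decay {μ C : ℝ}
    (hμ : ((Module.finrank ℝ V - k : ℕ) : ℝ) < μ) {F : AffGr k V → ℂ} (hFc : Continuous F)
    (hF : ∀ τ, ‖F τ‖ ≤ C * (1 + ‖τ.foot‖) ^ (-μ)) :
    Continuous fun ξ : Gr k V => ∫ τ, F τ ∂AffGr.fibre ξ := by
  rcases isEmpty_or_nonempty (Gr k V) with h | ⟨⟨W⟩⟩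
  · exact continuous_iff_continuousAt.mpr fun ξ => h.elim ξ
  rw [(Gr.isQuotientMap_rotate W).continuous_iff]
  have h1 : ((fun ξ : Gr k V => ∫ τ, F τ ∂AffGr.fibre ξ) ∘ fun U : Orth V => Gr.rotate U W) =
      fun U : Orth V => ∫ u : W.subᗮ, F (AffGr.rotate U (AffGr.of W (u : V))) ∂eucl W.subᗮ := by
    funext U
    simp only [Function.comp]
    rw [← AffGr.map_rotate_fibre, integral_map (AffGr.continuous_rotate U).measurable.aemeasurable
      hFc.measurable.aestronglyMeasurable, AffGr.integral_fibre]
  rw [h1]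
  have hof : Continuous fun u : W.subᗮ => AffGr.of W (u : V) :=
    AffGr.continuous_of continuous_const continuous_subtype_val fun x => x.2
  have hbound : Integrable (fun u : W.subᗮ => C * (1 + ‖(u : V)‖) ^ (-μ)) (eucl W.subᗮ) := by
    let _ : MeasureSpace W.subᗮ := measureSpaceOfInnerProductSpace
    exact (integrable_one_add_norm (E := W.subᗮ) (μ := volume)
      (by rwa [W.finrank_orthogonal])).const_mul C
  refine continuous_of_dominated (bound := fun u : W.subᗮ => C * (1 + ‖(u : V)‖) ^ (-μ))
    (fun U => ?_) (fun U => ae_of_all _ fun u => ?_) hbound (ae_of_all _ fun u => ?_)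
  · exact (hFc.comp (AffGr.continuous_rotate_comp continuous_const hof)).measurable.aestronglyMeasurable
  · have h2 := hF (AffGr.rotate U (AffGr.of W (u : V)))
    rwa [AffGr.foot_rotate, ContinuousLinearMap.norm_map_of_mem_unitary U.2,
      AffGr.foot_of _ _ u.2] at h2
  · exact hFc.comp (AffGr.continuous_rotate_comp continuous_id continuous_const)

end Decay

end RadonGrassmann

end

/-! ### The two cases of the theorem -/

open RadonGrassmann in
theorem lemma3p4 (n k k' κ : ℕ) (hk : 0 < k) (hkk' : k < k') (hκ : k ≤ κ) (hn : k' + κ < n) :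
    -- (i) the `L^p` case
    (∀ (p : ℝ) (f : AffGr k (EuclideanSpace ℝ (Fin n)) → ℂ),
      1 ≤ p → p < ((n : ℝ) - k) / ((k' : ℝ) - k + κ) →
      MemLp f (ENNReal.ofReal p) (AffGr.measure k (EuclideanSpace ℝ (Fin n))) →
      (∀ᵐ ζ ∂(AffGr.measure (k' + κ) (EuclideanSpace ℝ (Fin n))),
        radonAbs f ζ < ∞ ∧
        (∀ᵐ ξ ∂(Gr.measure k ζ.dir.sub), SliceConverges f ζ.dir.sub ζ.foot ξ) ∧
        Integrable (sliceInt f ζ.dir.sub ζ.foot) (Gr.measure k ζ.dir.sub) ∧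
        ∀ᵐ η ∂(Gr.measure k' ζ.dir.sub), SliceIdentity f ζ.dir.sub ζ.foot η) ∧
      -- for a Borel function `f`, this holds at every plane at which `R̃|f|` is finite
      (Measurable f → ∀ ζ : AffGr (k' + κ) (EuclideanSpace ℝ (Fin n)), radonAbs f ζ < ∞ →
        (∀ᵐ ξ ∂(Gr.measure k ζ.dir.sub), SliceConverges f ζ.dir.sub ζ.foot ξ) ∧
        Integrable (sliceInt f ζ.dir.sub ζ.foot) (Gr.measure k ζ.dir.sub) ∧
        ∀ᵐ η ∂(Gr.measure k' ζ.dir.sub), SliceIdentity f ζ.dir.sub ζ.foot η)) ∧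
    -- (ii) the case of continuous functions
    (∀ (μ : ℝ) (f : AffGr k (EuclideanSpace ℝ (Fin n)) → ℂ),
      (k' : ℝ) - k + κ < μ → MemC μ f →
      ∀ ζ : AffGr (k' + κ) (EuclideanSpace ℝ (Fin n)),
        radonAbs f ζ < ∞ ∧
        (∀ ξ : Gr k ζ.dir.sub, SliceConverges f ζ.dir.sub ζ.foot ξ) ∧
        Continuous (sliceInt f ζ.dir.sub ζ.foot : Gr k ζ.dir.sub → ℂ) ∧
        Integrable (sliceInt f ζ.dir.sub ζ.foot) (Gr.measure k ζ.dir.sub) ∧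
        ∀ η : Gr k' ζ.dir.sub, SliceIdentity f ζ.dir.sub ζ.foot η) := by
  have hfin : Module.finrank ℝ (EuclideanSpace ℝ (Fin n)) = n := finrank_euclideanSpace_fin
  have hη : ∀ ζ : AffGr (k' + κ) (EuclideanSpace ℝ (Fin n)), Nonempty (Gr k' ζ.dir.sub) :=
    fun ζ => Gr.nonempty_of_le (by rw [ζ.dir.finrank_eq]; omega)
  have hξ : ∀ (ζ : AffGr (k' + κ) (EuclideanSpace ℝ (Fin n))) (η : Gr k' ζ.dir.sub),
      Nonempty (Gr k η.sub) := fun ζ η => Gr.nonempty_of_le (by rw [η.finrank_eq]; omega)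
  have hdim : ((k' + κ : ℕ) : ℝ) - k = (k' : ℝ) - k + κ := by push_cast; ring
  have hkk : (k : ℝ) < k' := by exact_mod_cast hkk'
  have hκ0 : (0 : ℝ) ≤ κ := Nat.cast_nonneg κ
  refine ⟨fun p f hp1 hp hf => ⟨?_, fun hfm ζ hζ => ?_⟩, fun μ f hμ hf ζ => ?_⟩
  · obtain ⟨W⟩ := Gr.nonempty_of_le (V := EuclideanSpace ℝ (Fin n)) (k := k' + κ)
      (by rw [hfin]; omega)
    obtain ⟨ξ₀⟩ := Gr.nonempty_of_le (V := W.sub) (k := k) (by rw [W.finrank_eq]; omega)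
    rw [lt_div_iff₀ (by linarith)] at hp
    have hae := AffGr.ae_integrable_of_memLp W ξ₀ hp1 (by rw [hdim, hfin]; exact hp) hf
    filter_upwards [hae] with ζ hζ
    obtain ⟨η⟩ := hη ζ
    obtain ⟨ξ⟩ := hξ ζ η
    refine ⟨?_, slice_of_integrable ζ.foot_mem η ξ hζ⟩
    rw [radonAbs_eq]
    exact planeAbs_lt_top hζ
  · obtain ⟨η⟩ := hη ζ
    obtain ⟨ξ⟩ := hξ ζ η
    rw [radonAbs_eq] at hζ
    exact slice_of_integrable ζ.foot_mem η ξ (integrable_of_planeAbs_lt_top hfm ζ.foot_mem hζ)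
  · have hμ0 : 0 < μ := by linarith
    obtain ⟨C, hC⟩ := hf.exists_bound hμ0
    have hF := norm_emb_subtype_le hμ0 hC ζ.foot_mem
    have hFc : Continuous fun τ : AffGr k ζ.dir.sub =>
        f (AffGr.emb ζ.dir.sub.subtypeₗᵢ ζ.foot τ) :=
      hf.1.comp (AffGr.continuous_emb_subtype ζ.foot_mem)
    -- In the ambient space `h` of dimension `k' + κ` the complement of `ξ` has dimension `k' + κ -
    -- k`, the stated threshold; the natural subtraction is genuine because `k < k'`.
    have hμ' : ((Module.finrank ℝ ζ.dir.sub - k : ℕ) : ℝ) < μ := by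
      rw [ζ.dir.finrank_eq, Nat.cast_sub (by omega), hdim]
      exact hμ
    have hint := integrable_measure_of_decay hμ' hFc hF
    obtain ⟨η⟩ := hη ζ
    obtain ⟨ξ⟩ := hξ ζ η
    refine ⟨?_, fun ξ => ?_, ?_, (slice_of_integrable ζ.foot_mem η ξ hint).2.1, fun η => ?_⟩
    · rw [radonAbs_eq]
      exact planeAbs_lt_top hint
    · rw [sliceConverges_iff]
      exact integrable_fibre_of_decay hμ' hFc hF ξ
    · exact (continuous_integral_fibre_of_decay hμ' hFc hF).congr
        fun ξ => (sliceInt_eq f _ _ ξ).symm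
    -- The decay gives integrability over the planes with direction in this particular `η`, hence no
    -- exceptional set.
    · exact sliceIdentity_of_integrable ζ.foot_mem η
        (integrable_dirMeasure_of_decay hμ' hFc hF η.sub)
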